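/- **Theorem 1.4 (Logarithmic Lemma).** Let $n\ge h\ge 1$ and $m\ge 0$ be integers, and let $Q:=n+m(n-h)$, where $2n>Q$. Write $\mathbb R^n=\mathbb R^h\times\mathbb R^{n-h}$, $|x|_h:=(x_1^2+\dots+x_h^2)^{1/2}$, and let $\mathbb G^n$ be $\mathbb R^n$ with Lebesgue measure and the Carnot–Carathéodory distance $d_C$ of the vector fields $X_i=\partial_{x_i}$ $(1\le i\le h)$ and $X_{h+j}=|x|_h^m\,\partial_{x_{h+j}}$ $(1\le j\le n-h)$, that is, $d_C(x,y)$ is the infimum of $\int_0^1\|\gamma'(t)\|\,dt$ over the absolutely continuous curves $\gamma:[0,1]\to\mathbb R^n$ from $x$ to $y$ with $\gamma'(t)\in\mathrm{span}\{X_1(\gamma(t)),\dots,X_n(\gamma(t))\}$ for a.e. $t$, where $\|v\|$ is the least Euclidean length of a vector $a$ with $v=\sum_i a_iX_i$. Let $B(x_0,r)=\{x: d_C(x,x_0)<r\}$. Let $p>\max\{m(n-h),1\}$ and $0<s<1-\frac{m(n-h)}{p}$. Let $W^{s,p}(\mathbb G^n)$ be the set of all $v\in L^p(\mathbb R^n)$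 with $\iint d_C(x,y)^{-Q-sp}|v(x)-v(y)|^p\,dx\,dy<\infty$, and, for a bounded open set $\Omega\subset\mathbb G^n$, let $W^{s,p}_0(\Omega)$ be the set of those $v\in W^{s,p}(\mathbb G^n)$ that vanish a.e. outside $\Omega$. For $g\in W^{s,p}(\mathbb G^n)$, a weak supersolution of the problem $\mathcal Lu=0$ in $\Omega$, $u=g$ in $\mathbb G^n\setminus\Omega$, is a function $u\in W^{s,p}(\mathbb G^n)$ with $(g-u)_+\in W^{s,p}_0(\Omega)$ and $$\int_{\mathbb G^n}\int_{\mathbb G^n} d_C(x,y)^{-Q-sp}|u(x)-u(y)|^{p-2}(u(x)-u(y))(\eta(x)-\eta(y))\,dx\,dy\ge 0$$ for every nonnegative $\eta\in W^{s,p}_0(\Omega)$. For a function $v$ put $$\mathrm{Tail}(v;x_0,R)=\Big[R^{sp}\int_{\mathbb G^n\setminus B(x_0,R)}|v(x)|^{p-1}d_C(x,x_0)^{-Q-sp}\,dx\Big]^{\frac1{p-1}}.$$ Then there is a constant $c>0$, depending only on $n,h,p,s,m$, such that for every bounded open $\Omega\subset\mathbb G^n$, every $g\in W^{s,p}(\mathbb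 G^n)$, every weak supersolution $u$ as above, and every ball $B(x_0,R)\subset\Omega$ with $u\ge 0$ a.e. in $B(x_0,R)$, the estimate $$\int_{B_r}\int_{B_r} d_C(x,y)^{-Q-sp}\Big|\log\Big(\frac{u(x)+d}{u(y)+d}\Big)\Big|^p dx\,dy\le c\,r^{2n-Q-sp}\big(|x_0|_h+2r\big)^{m(n-h)}\Big\{d^{1-p}\Big(\frac rR\Big)^{sp}r^{Q-n}\,[\mathrm{Tail}(u_-;x_0,R)]^{p-1}+\big(|x_0|_h+2r\big)^{m(n-h)}\Big\}$$ holds for every ball $B_r=B(x_0,r)\subset B(x_0,R/2)$, $r>0$, and every $d>0$, where $u_-:=\max\{-u,0\}$. -/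

import Mathlib

open MeasureTheory Set

open scoped ENNReal

/-- The space `ℝⁿ` with its Euclidean norm and Lebesgue measure `volume`, on which the
Grushin-type geometry `𝔾ⁿ` is built.  Coordinates are numbered `0, …, n - 1`; the first `h`
of them span the factor `ℝʰ` of `ℝⁿ = ℝʰ × ℝⁿ⁻ʰ`. -/
abbrev GSpace (n : ℕ) : Type := EuclideanSpace ℝ (Fin n)

/-- `|x|_h`, the Euclidean length of the first `h` coordinates of `x`. -/
noncomputable def hNorm {n : ℕ} (h : ℕ) (x : GSpace n) : ℝ :=
  Real.sqrt (∑ i : Fin n, if (i : ℕ) < h then x i ^ 2 else 0)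

/-- The coefficient of the `i`-th vector field at `x`: `1` for the first `h` fields, and
`|x|_h ^ m` for the remaining `n - h` fields. -/
noncomputable def grushinWeight {n : ℕ} (h m : ℕ) (x : GSpace n) (i : Fin n) : ℝ :=
  if (i : ℕ) < h then 1 else hNorm h x ^ m

/-- The vector fields `X_i = ∂/∂x_i` for `i ≤ h` and `X_{h+j} = |x|_h ^ m ∂/∂x_{h+j}`
for `j ≤ n - h`. -/
noncomputable def grushinField {n : ℕ} (h m : ℕ) (i : Fin n) (x : GSpace n) : GSpace n :=
  grushinWeight h m x i • EuclideanSpace.single i (1 : ℝ)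

/-- The horizontal space `span {X_1(x), …, X_n(x)}` at `x`. -/
noncomputable def horizontalSpace {n : ℕ} (h m : ℕ) (x : GSpace n) : Submodule ℝ (GSpace n) :=
  Submodule.span ℝ (range fun i : Fin n => grushinField h m i x)

/-- The norm `‖v‖` of a horizontal vector `v` at `x` for which the non-vanishing fields among
`X_1(x), …, X_n(x)` are orthonormal: the square root of the sum of the squares of the
coefficients of `v`.  (Where a field vanishes, the quotient is `0 / 0 = 0` on horizontal
vectors; see `horizontalNorm_isLeast`.) -/
noncomputable def horizontalNorm {n : ℕ} (h m : ℕ) (x v : GSpace n) : ℝ :=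
  Real.sqrt (∑ i : Fin n, (v i / grushinWeight h m x i) ^ 2)

theorem sum_smul_grushinField_apply {n : ℕ} (h m : ℕ) (x a : GSpace n) (k : Fin n) :
    (∑ i : Fin n, a i • grushinField h m i x) k = a k * grushinWeight h m x k := by
  simp [grushinField, Finset.sum_apply, Pi.single_apply]

/-- On horizontal vectors `horizontalNorm` is the least Euclidean length of a coefficient vector
`a` with `v = ∑ i, a i • X_i(x)`. -/
theorem horizontalNorm_isLeast {n : ℕ} (h m : ℕ) (x v : GSpace n)
    (hv : v ∈ horizontalSpace h m x) :
    IsLeast {l : ℝ | ∃ a : GSpace n, ∑ i : Fin n, a i • grushinField h m i x = v ∧ l = ‖a‖}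
      (horizontalNorm h m x v) := by
  obtain ⟨b, hb⟩ := (Submodule.mem_span_range_iff_exists_fun ℝ).1 hv
  have hb' : ∀ k, v k = b k * grushinWeight h m x k := by
    intro k
    rw [← hb]
    exact sum_smul_grushinField_apply h m x (WithLp.toLp 2 b) k
  constructor
  · refine ⟨WithLp.toLp 2 fun i => v i / grushinWeight h m x i, ?_, ?_⟩
    · ext k
      rw [sum_smul_grushinField_apply]
      by_cases hw : grushinWeight h m x k = 0
      · simp [hb' k, hw]
      · simp [hw]
    · simp only [horizontalNorm, EuclideanSpace.norm_eq, Real.norm_eq_abs, sq_abs]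
  · rintro l ⟨a, ha, rfl⟩
    rw [horizontalNorm, EuclideanSpace.norm_eq]
    refine Real.sqrt_le_sqrt (Finset.sum_le_sum fun k _ => ?_)
    have hk : v k = a k * grushinWeight h m x k := by
      rw [← ha]
      exact sum_smul_grushinField_apply h m x a k
    by_cases hw : grushinWeight h m x k = 0
    · simp [hk, hw, sq_nonneg]
    · simp [hk, hw]

/-- A horizontal curve from `x` to `y`: an absolutely continuous curve on `[0, 1]` whose
velocity is horizontal at almost every time. -/
structure IsHorizontalCurve {n : ℕ} (h m : ℕ) (x y : GSpace n) (γ : ℝ → GSpace n) : Prop where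
  absCont : AbsolutelyContinuousOnInterval γ 0 1
  source : γ 0 = x
  target : γ 1 = y
  horizontal : ∀ᵐ t ∂(volume.restrict (Icc (0 : ℝ) 1)), deriv γ t ∈ horizontalSpace h m (γ t)

/-- The length `∫₀¹ ‖γ'(t)‖ dt` of a horizontal curve, possibly infinite. -/
noncomputable def curveLength {n : ℕ} (h m : ℕ) (γ : ℝ → GSpace n) : ℝ≥0∞ :=
  ∫⁻ t in Icc (0 : ℝ) 1, ENNReal.ofReal (horizontalNorm h m (γ t) (deriv γ t))

/-- The Carnot–Carathéodory distance: the infimum of the lengths of horizontal curves from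
`x` to `y` (it is finite for `h ≥ 1`, as any two points are joined by a horizontal curve of
finite length). -/
noncomputable def dC {n : ℕ} (h m : ℕ) (x y : GSpace n) : ℝ :=
  (⨅ (γ : ℝ → GSpace n) (_ : IsHorizontalCurve h m x y γ), curveLength h m γ).toReal

/-- The open Carnot–Carathéodory ball `B(x₀, r)`. -/
def ccBall {n : ℕ} (h m : ℕ) (x₀ : GSpace n) (r : ℝ) : Set (GSpace n) :=
  {x | dC h m x x₀ < r}

/-- The homogeneous dimension `Q = n + m (n - h)` (used for `h ≤ n` only). -/
def homDim (n h m : ℕ) : ℕ := n + m * (n - h)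

/-- The kernel `d_C(x, y) ^ (-Q - s p)`. -/
noncomputable def gKernel {n : ℕ} (h m : ℕ) (s p : ℝ) (x y : GSpace n) : ℝ :=
  dC h m x y ^ (-(homDim n h m : ℝ) - s * p)

/-- `∬ |u(x) - u(y)| ^ p d_C(x, y) ^ (-Q - s p) dx dy`, the `p`-th power of the Gagliardo
seminorm of `u` on `𝔾ⁿ`. -/
noncomputable def gagliardo {n : ℕ} (h m : ℕ) (s p : ℝ) (u : GSpace n → ℝ) : ℝ≥0∞ :=
  ∫⁻ z : GSpace n × GSpace n, ENNReal.ofReal (gKernel h m s p z.1 z.2 * |u z.1 - u z.2| ^ p)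

/-- Membership in the fractional Sobolev space `W^{s,p}(𝔾ⁿ)`. -/
def MemWsp {n : ℕ} (h m : ℕ) (s p : ℝ) (u : GSpace n → ℝ) : Prop :=
  MemLp u (ENNReal.ofReal p) volume ∧ gagliardo h m s p u < ∞

/-- Membership in `W_0^{s,p}(Ω)`: functions of `W^{s,p}(𝔾ⁿ)` that vanish almost everywhere
outside `Ω`. -/
def MemWsp0 {n : ℕ} (h m : ℕ) (s p : ℝ) (Ω : Set (GSpace n)) (v : GSpace n → ℝ) : Prop :=
  MemWsp h m s p v ∧ ∀ᵐ x, x ∉ Ω → v x = 0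

/-- The weak form
`∬ d_C(x, y) ^ (-Q - s p) |u(x) - u(y)| ^ (p - 2) (u(x) - u(y)) (η(x) - η(y)) dx dy`. -/
noncomputable def weakForm {n : ℕ} (h m : ℕ) (s p : ℝ) (u η : GSpace n → ℝ) : ℝ :=
  ∫ z : GSpace n × GSpace n, gKernel h m s p z.1 z.2 *
    |u z.1 - u z.2| ^ (p - 2) * (u z.1 - u z.2) * (η z.1 - η z.2)

/-- Weak supersolutions of `ℒ u = 0` in `Ω`, `u = g` outside `Ω`: `u` lies in `W^{s,p}(𝔾ⁿ)` with
`(g - u)₊ ∈ W_0^{s,p}(Ω)`, and the weak form is nonnegative on every nonnegative test function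
of `W_0^{s,p}(Ω)`. -/
structure IsWeakSupersolution {n : ℕ} (h m : ℕ) (s p : ℝ) (Ω : Set (GSpace n))
    (g u : GSpace n → ℝ) : Prop where
  mem : MemWsp h m s p u
  boundary : MemWsp0 h m s p Ω fun x => max (g x - u x) 0
  weak : ∀ η : GSpace n → ℝ, MemWsp0 h m s p Ω η → (∀ᵐ x, 0 ≤ η x) → 0 ≤ weakForm h m s p u η

/-- The nonlocal tail
`Tail(v; x₀, R) = (R ^ (s p) ∫_{𝔾ⁿ ∖ B(x₀, R)} |v(x)| ^ (p - 1) d_C(x, x₀) ^ (-Q - s p) dx)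
  ^ (1 / (p - 1))`,
with values in `[0, ∞]`. -/
noncomputable def gTail {n : ℕ} (h m : ℕ) (s p : ℝ) (v : GSpace n → ℝ) (x₀ : GSpace n)
    (R : ℝ) : ℝ≥0∞ :=
  (ENNReal.ofReal (R ^ (s * p)) * ∫⁻ x in (ccBall h m x₀ R)ᶜ,
    ENNReal.ofReal (|v x| ^ (p - 1) * gKernel h m s p x x₀)) ^ (1 / (p - 1))

/-! The supersolution is tested with η = φ^p (u₊ + d)^{1-p}, where φ is a cutoff equal to 1 on B_r
and to 0 outside B(x₀, 3r/2). Using u₊ rather than u keeps η bounded on the whole space, where u may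
be negative. Write K for the kernel. On B_r × B_r, where φ = 1, the integrand of the weak form is at
most -c K |log((u(x)+d)/(u(y)+d))|^p. Everywhere it is at most C K |φ(x)-φ(y)|^p (1 +
d^{1-p}(τ(x)+τ(y))), with τ = u_-^{p-1} off B(x₀, R) and τ = 0 on it. Since the weak form is
nonnegative, the logarithmic energy is bounded by the Gagliardo energy of φ plus a tail term
(`exists_lintegral_log_le`). The pointwise bounds are collected in `exists_weakForm_integrand_le`;
by homogeneity they reduce to inequalities in t = A/B ≥ 1, namely `exists_log_rpow_le` and
`exists_cutoff_le`.

The geometry enters only through upper bounds for volumes. A curve of length ρ moves the first h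
coordinates by at most ρ and the others by at most ρ times the largest weight it meets, so a ball
lies in a box and |B(x, ρ)| ≤ C ρ^n (|x|_h + ρ)^{m(n-h)} (`volume_ccBall_le`). The cutoff is
Lipschitz for d_C, and its energy is summed over dyadic annuli
(`exists_lintegral_gKernel_mul_min_le`). At large scales the volume grows with degree Q and the
kernel leaves the decay ρ^{-sp}. At small scales the volume is only of order ρ^n, and the gain ρ^p
from the Lipschitz bound makes the series converge because sp + m(n-h) < p, which is the hypothesis
on s. One factor (|x₀|_h + 2r)^{m(n-h)} comes from this kernel integral and the other from the
volume of B(x₀, 2r).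

In the tail term one point is in the support of φ and the other outside B(x₀, R) ⊇ B(x₀, 2r), so
d_C(x, y) is comparable to d_C(y, x₀) (`gKernel_le_of_far`) and the double integral splits into a
product. -/

/-! ### Reparametrisation of curves and the horizontal norm -/

theorem disjoint_uIoc_iff {a b c d : ℝ} :
    Disjoint (uIoc a b) (uIoc c d) ↔ min (max a b) (max c d) ≤ max (min a b) (min c d) := by
  rw [uIoc, uIoc, Ioc_disjoint_Ioc]

/-- Absolute continuity is preserved by a monotone or antitone Lipschitz change of parameter. -/
theorem AbsolutelyContinuousOnInterval.comp_lipschitz {X : Type*} [PseudoMetricSpace X]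
    {f : ℝ → X} {g : ℝ → ℝ} {a b c d K : ℝ} (hf : AbsolutelyContinuousOnInterval f c d)
    (hK : 0 < K) (hg : ∀ x y, |g x - g y| ≤ K * |x - y|) (hmono : Monotone g ∨ Antitone g)
    (hmaps : ∀ x ∈ uIcc a b, g x ∈ uIcc c d) :
    AbsolutelyContinuousOnInterval (fun t => f (g t)) a b := by
  rw [absolutelyContinuousOnInterval_iff] at hf ⊢
  intro ε hε
  obtain ⟨δ, hδ, H⟩ := hf ε hε
  refine ⟨δ / K, by positivity, fun E hE hlt => ?_⟩
  refine H (E.1, fun i => (g (E.2 i).1, g (E.2 i).2)) ⟨fun i hi => ?_, ?_⟩ ?_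
  · exact ⟨hmaps _ (hE.1 i hi).1, hmaps _ (hE.1 i hi).2⟩
  · intro i hi j hj hij
    have h1 := hE.2 hi hj hij
    -- Monotonicity is what keeps disjoint intervals disjoint: the criterion involves only `min` and
    -- `max`, which a monotone map preserves and an antitone one exchanges.
    simp only [Function.onFun, disjoint_uIoc_iff] at h1 ⊢
    rcases hmono with hm | hm
    · simpa only [hm.map_max, hm.map_min] using hm h1
    · simpa only [hm.map_max, hm.map_min] using hm h1
  · calc _ ≤ ∑ i ∈ Finset.range E.1, K * dist (E.2 i).1 (E.2 i).2 :=
          Finset.sum_le_sum fun i _ => by simpa only [Real.dist_eq] using hg _ _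
      _ = K * ∑ i ∈ Finset.range E.1, dist (E.2 i).1 (E.2 i).2 := (Finset.mul_sum _ _ _).symm
      _ < K * (δ / K) := by gcongr
      _ = δ := by field_simp

theorem horizontalNorm_nonneg {n : ℕ} (h m : ℕ) (x v : GSpace n) : 0 ≤ horizontalNorm h m x v :=
  Real.sqrt_nonneg _

theorem horizontalNorm_smul {n : ℕ} (h m : ℕ) (x v : GSpace n) (c : ℝ) :
    horizontalNorm h m x (c • v) = |c| * horizontalNorm h m x v := by
  rw [horizontalNorm, horizontalNorm, ← Real.sqrt_sq_eq_abs, ← Real.sqrt_mul (sq_nonneg c),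
    Finset.mul_sum]
  congr 1
  refine Finset.sum_congr rfl fun i _ => ?_
  simp only [PiLp.smul_apply, smul_eq_mul]
  ring

theorem hNorm_nonneg {n : ℕ} (h : ℕ) (x : GSpace n) : 0 ≤ hNorm h x := Real.sqrt_nonneg _

theorem grushinWeight_nonneg {n : ℕ} (h m : ℕ) (x : GSpace n) (i : Fin n) :
    0 ≤ grushinWeight h m x i := by
  unfold grushinWeight
  split_ifs
  · exact zero_le_one
  · exact pow_nonneg (hNorm_nonneg h x) m

theorem mem_horizontalSpace_iff {n : ℕ} {h m : ℕ} {x v : GSpace n} :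
    v ∈ horizontalSpace h m x ↔ ∀ i, grushinWeight h m x i = 0 → v i = 0 := by
  rw [horizontalSpace, Submodule.mem_span_range_iff_exists_fun]
  constructor
  · rintro ⟨b, rfl⟩ i hi
    have := sum_smul_grushinField_apply h m x (WithLp.toLp 2 b) i
    simp only [hi, mul_zero] at this
    exact this
  · intro H
    refine ⟨fun i => v i / grushinWeight h m x i, ?_⟩
    ext k
    have := sum_smul_grushinField_apply h m x
      (WithLp.toLp 2 fun i => v i / grushinWeight h m x i) k
    refine this.trans ?_
    by_cases hw : grushinWeight h m x k = 0
    · simp [hw, H k hw]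
    · simp [hw]

theorem abs_apply_le_of_mem_horizontalSpace {n : ℕ} {h m : ℕ} {x v : GSpace n}
    (hv : v ∈ horizontalSpace h m x) (i : Fin n) :
    |v i| ≤ grushinWeight h m x i * horizontalNorm h m x v := by
  by_cases hw : grushinWeight h m x i = 0
  · simp [hw, mem_horizontalSpace_iff.1 hv i hw]
  have hpos : 0 < grushinWeight h m x i :=
    lt_of_le_of_ne (grushinWeight_nonneg h m x i) (Ne.symm hw)
  rw [mul_comm, ← div_le_iff₀ hpos]
  have h1 : |v i| / grushinWeight h m x i = √((v i / grushinWeight h m x i) ^ 2) := by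
    rw [Real.sqrt_sq_eq_abs, abs_div, abs_of_pos hpos]
  rw [h1, horizontalNorm]
  exact Real.sqrt_le_sqrt (Finset.single_le_sum
    (f := fun i => (v i / grushinWeight h m x i) ^ 2) (fun j _ => sq_nonneg _) (Finset.mem_univ i))

/-! ### Construction of horizontal curves -/

/-- `x` and `y` are joined by a horizontal curve of length at most `L`. -/
def HorizontallyJoined {n : ℕ} (h m : ℕ) (x y : GSpace n) (L : ℝ≥0∞) : Prop :=
  ∃ γ : ℝ → GSpace n, IsHorizontalCurve h m x y γ ∧ curveLength h m γ ≤ L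

theorem ae_comp_affine {P : ℝ → Prop} (hP : ∀ᵐ t, P t) {a : ℝ} (ha : a ≠ 0) (b : ℝ) :
    ∀ᵐ t : ℝ, P (a * t + b) := by
  have h1 : Measure.QuasiMeasurePreserving (fun t : ℝ => a * t) := by
    refine ⟨by fun_prop, ?_⟩
    rw [Real.map_volume_mul_left ha]
    exact Measure.smul_absolutelyContinuous
  have h2 : Measure.QuasiMeasurePreserving (fun t : ℝ => t + b) :=
    (measurePreserving_add_right volume b).quasiMeasurePreserving
  exact (h2.comp h1).ae hP

theorem lintegral_comp_affine (F : ℝ → ℝ≥0∞) {a : ℝ} (ha : a ≠ 0) (b : ℝ) (s : Set ℝ)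
    (hs : MeasurableSet s) :
    ∫⁻ t in s, ENNReal.ofReal |a| * F (a * t + b) =
      ∫⁻ t in (fun t => a * t + b) '' s, F t := by
  refine (lintegral_image_eq_lintegral_abs_deriv_mul (f' := fun _ => a) hs (fun x _ => ?_)
    (fun x _ y _ hxy => ?_) F).symm
  · simpa using (((hasDerivAt_id x).const_mul a).add_const b).hasDerivWithinAt
  · simpa [ha] using hxy

theorem deriv_comp_affine {n : ℕ} (γ : ℝ → GSpace n) (a b t : ℝ) :
    deriv (fun t => γ (a * t + b)) t = a • deriv γ (a * t + b) := by
  have h1 := deriv_comp_mul_left a (fun s => γ (s + b)) t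
  rw [h1, deriv_comp_add_const]

theorem HorizontallyJoined.symm {n : ℕ} {h m : ℕ} {x y : GSpace n} {L : ℝ≥0∞}
    (H : HorizontallyJoined h m x y L) : HorizontallyJoined h m y x L := by
  obtain ⟨γ, hγ, hL⟩ := H
  have hd : ∀ t, deriv (fun t => γ (-1 * t + 1)) t = (-1 : ℝ) • deriv γ (-1 * t + 1) :=
    deriv_comp_affine γ (-1) 1
  refine ⟨fun t => γ (-1 * t + 1), ⟨?_, ?_, ?_, ?_⟩, ?_⟩
  · refine hγ.absCont.comp_lipschitz one_pos (fun u v => ?_) (Or.inr fun u v huv => ?_) ?_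
    · rw [one_mul, ← abs_neg]; apply le_of_eq; congr 1; ring
    · show -1 * v + 1 ≤ -1 * u + 1
      linarith
    · intro u hu
      rw [uIcc_of_le zero_le_one] at hu ⊢
      exact ⟨by linarith [hu.2], by linarith [hu.1]⟩
  · simp [hγ.target]
  · simp [hγ.source]
  · have h1 := hγ.horizontal
    rw [ae_restrict_iff' measurableSet_Icc] at h1 ⊢
    filter_upwards [ae_comp_affine h1 (by norm_num : (-1 : ℝ) ≠ 0) 1] with t ht htI
    rw [hd]
    exact Submodule.smul_mem _ _ (ht ⟨by linarith [htI.2], by linarith [htI.1]⟩)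
  · refine le_trans ?_ hL
    have h2 := lintegral_comp_affine
      (fun t => ENNReal.ofReal (horizontalNorm h m (γ t) (deriv γ t)))
      (by norm_num : (-1 : ℝ) ≠ 0) 1 (Icc 0 1) measurableSet_Icc
    have h3 : (fun t : ℝ => -1 * t + 1) '' Icc 0 1 ⊆ Icc 0 1 := by
      rintro _ ⟨t, ht, rfl⟩
      exact ⟨by linarith [ht.2], by linarith [ht.1]⟩
    refine le_trans (le_of_eq ?_) (h2.trans_le (lintegral_mono_set h3))
    refine lintegral_congr fun t => ?_
    simp only [hd, horizontalNorm_smul]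
    simp

theorem HorizontallyJoined.trans {n : ℕ} {h m : ℕ} {x y z : GSpace n} {L M : ℝ≥0∞}
    (H : HorizontallyJoined h m x y L) (H' : HorizontallyJoined h m y z M) :
    HorizontallyJoined h m x z (L + M) := by
  obtain ⟨γ, hγ, hL⟩ := H
  obtain ⟨σ, hσ, hM⟩ := H'
  -- One formula for the concatenation: on each half one of the two terms is frozen at `y`. Absolute
  -- continuity then follows from sums and Lipschitz reparametrisations, without gluing.
  set τ : ℝ → GSpace n := fun t => γ (min (2 * t) 1) + σ (max (2 * t - 1) 0) - y with hτ
  have e1 : ∀ t, t < 1 / 2 → τ t = γ (2 * t + 0) := by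
    intro t ht
    have a1 : min (2 * t) 1 = 2 * t + 0 := by rw [min_eq_left (by linarith), add_zero]
    have a2 : max (2 * t - 1) 0 = 0 := max_eq_right (by linarith)
    simp only [hτ, a1, a2, hσ.source, add_sub_cancel_right]
  have e2 : ∀ t, 1 / 2 < t → τ t = σ (2 * t + -1) := by
    intro t ht
    have a1 : min (2 * t) 1 = 1 := min_eq_right (by linarith)
    have a2 : max (2 * t - 1) 0 = 2 * t + -1 := by rw [max_eq_left (by linarith)]; ring
    simp only [hτ, a1, a2, hγ.target, add_sub_cancel_left]
  have d1 : ∀ t, t < 1 / 2 → deriv τ t = (2 : ℝ) • deriv γ (2 * t + 0) := by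
    intro t ht
    rw [← deriv_comp_affine]
    refine Filter.EventuallyEq.deriv_eq ?_
    filter_upwards [Iio_mem_nhds ht] with u hu using e1 u hu
  have d2 : ∀ t, 1 / 2 < t → deriv τ t = (2 : ℝ) • deriv σ (2 * t + -1) := by
    intro t ht
    rw [← deriv_comp_affine]
    refine Filter.EventuallyEq.deriv_eq ?_
    filter_upwards [Ioi_mem_nhds ht] with u hu using e2 u hu
  have hne : ∀ᵐ t : ℝ, t ≠ 1 / 2 := by
    simp [ae_iff, measure_singleton]
  have hac : AbsolutelyContinuousOnInterval τ 0 1 := by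
    have c1 : AbsolutelyContinuousOnInterval (fun t => γ (min (2 * t) 1)) 0 1 := by
      refine hγ.absCont.comp_lipschitz two_pos (fun u v => ?_) (Or.inl fun u v huv => ?_) ?_
      · refine (abs_min_sub_min_le_max _ _ _ _).trans ?_
        rw [sub_self, abs_zero, max_eq_left (abs_nonneg _), ← mul_sub, abs_mul, abs_two]
      · show min (2 * u) 1 ≤ min (2 * v) 1
        gcongr
      · intro u hu
        rw [uIcc_of_le zero_le_one] at hu ⊢
        exact ⟨le_min (by linarith [hu.1]) zero_le_one, min_le_right _ _⟩
    have c2 : AbsolutelyContinuousOnInterval (fun t => σ (max (2 * t - 1) 0)) 0 1 := by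
      refine hσ.absCont.comp_lipschitz two_pos (fun u v => ?_) (Or.inl fun u v huv => ?_) ?_
      · refine (abs_max_sub_max_le_max _ _ _ _).trans ?_
        rw [sub_self, abs_zero, max_eq_left (abs_nonneg _), sub_sub_sub_cancel_right, ← mul_sub,
          abs_mul, abs_two]
      · show max (2 * u - 1) 0 ≤ max (2 * v - 1) 0
        gcongr
      · intro u hu
        rw [uIcc_of_le zero_le_one] at hu ⊢
        exact ⟨le_max_right _ _, max_le (by linarith [hu.2]) zero_le_one⟩
    have c3 : AbsolutelyContinuousOnInterval (fun _ : ℝ => y) 0 1 :=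
      (contDiff_const.contDiffOn).absolutelyContinuousOnInterval
    exact (c1.add c2).sub c3
  refine ⟨τ, ⟨hac, ?_, ?_, ?_⟩, ?_⟩
  · rw [e1 0 (by norm_num)]; simp [hγ.source]
  · rw [e2 1 (by norm_num)]; norm_num [hσ.target]
  · have h1 := hγ.horizontal
    have h2 := hσ.horizontal
    rw [ae_restrict_iff' measurableSet_Icc] at h1 h2 ⊢
    filter_upwards [ae_comp_affine h1 (by norm_num : (2 : ℝ) ≠ 0) 0,
      ae_comp_affine h2 (by norm_num : (2 : ℝ) ≠ 0) (-1), hne] with t ht1 ht2 ht htI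
    rcases lt_or_gt_of_ne ht with hlt | hgt
    · rw [d1 t hlt, e1 t hlt]
      exact Submodule.smul_mem _ _ (ht1 ⟨by linarith [htI.1], by linarith⟩)
    · rw [d2 t hgt, e2 t hgt]
      exact Submodule.smul_mem _ _ (ht2 ⟨by linarith, by linarith [htI.2]⟩)
  · have hsub : Icc (0 : ℝ) 1 ⊆ Ico 0 (1 / 2) ∪ ({1 / 2} ∪ Ioc (1 / 2) 1) := by
      intro t ht
      rcases lt_trichotomy t (1 / 2) with hlt | heq | hgt
      · exact Or.inl ⟨ht.1, hlt⟩
      · exact Or.inr (Or.inl heq)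
      · exact Or.inr (Or.inr ⟨hgt, ht.2⟩)
    have b1 : ∫⁻ t in Ico (0 : ℝ) (1 / 2), ENNReal.ofReal (horizontalNorm h m (τ t) (deriv τ t))
        ≤ L := by
      have h2 := lintegral_comp_affine
        (fun t => ENNReal.ofReal (horizontalNorm h m (γ t) (deriv γ t)))
        (by norm_num : (2 : ℝ) ≠ 0) 0 (Ico 0 (1 / 2)) measurableSet_Ico
      refine le_trans ?_ hL
      have h3 : (fun t : ℝ => 2 * t + 0) '' Ico 0 (1 / 2) ⊆ Icc 0 1 := by
        rintro _ ⟨t, ht, rfl⟩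
        exact ⟨by linarith [ht.1], by linarith [ht.2]⟩
      refine le_trans (le_of_eq ?_) (h2.trans_le (lintegral_mono_set h3))
      refine setLIntegral_congr_fun measurableSet_Ico fun t ht => ?_
      simp only [d1 t ht.2, e1 t ht.2, horizontalNorm_smul]
      rw [ENNReal.ofReal_mul (abs_nonneg _)]
    have b2 : ∫⁻ t in Ioc (1 / 2 : ℝ) 1, ENNReal.ofReal (horizontalNorm h m (τ t) (deriv τ t))
        ≤ M := by
      have h2 := lintegral_comp_affine
        (fun t => ENNReal.ofReal (horizontalNorm h m (σ t) (deriv σ t)))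
        (by norm_num : (2 : ℝ) ≠ 0) (-1) (Ioc (1 / 2) 1) measurableSet_Ioc
      refine le_trans ?_ hM
      have h3 : (fun t : ℝ => 2 * t + -1) '' Ioc (1 / 2) 1 ⊆ Icc 0 1 := by
        rintro _ ⟨t, ht, rfl⟩
        exact ⟨by linarith [ht.1], by linarith [ht.2]⟩
      refine le_trans (le_of_eq ?_) (h2.trans_le (lintegral_mono_set h3))
      refine setLIntegral_congr_fun measurableSet_Ioc fun t ht => ?_
      simp only [d2 t ht.1, e2 t ht.1, horizontalNorm_smul]
      rw [ENNReal.ofReal_mul (abs_nonneg _)]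
    rw [curveLength]
    refine (lintegral_mono_set hsub).trans ((lintegral_union_le _ _ _).trans ?_)
    refine add_le_add b1 ((lintegral_union_le _ _ _).trans ?_)
    rw [Measure.restrict_singleton]
    simpa using b2

/-- A segment along which the relevant fields have weight at least `w`. -/
theorem horizontallyJoined_segment {n : ℕ} {h m : ℕ} (x v : GSpace n) {w : ℝ} (hw : 0 < w)
    (H : ∀ t ∈ Icc (0 : ℝ) 1, ∀ i, v i ≠ 0 → w ≤ grushinWeight h m (x + t • v) i) :
    HorizontallyJoined h m x (x + v) (ENNReal.ofReal (‖v‖ / w)) := by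
  have hd : ∀ t : ℝ, deriv (fun t : ℝ => x + t • v) t = v := fun t => by
    simpa using (((hasDerivAt_id t).smul_const v).const_add x).deriv
  refine ⟨fun t => x + t • v, ⟨?_, by simp, by simp, ?_⟩, ?_⟩
  · exact ((contDiff_const.add (contDiff_id.smul contDiff_const)).contDiffOn
      ).absolutelyContinuousOnInterval
  · refine (ae_restrict_iff' measurableSet_Icc).2 (Filter.Eventually.of_forall fun t ht => ?_)
    rw [hd, mem_horizontalSpace_iff]
    intro i hi
    by_contra hne
    linarith [H t ht i hne]
  · have key : ∀ t ∈ Icc (0 : ℝ) 1, horizontalNorm h m (x + t • v) v ≤ ‖v‖ / w := by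
      intro t ht
      rw [horizontalNorm, EuclideanSpace.norm_eq]
      refine Real.sqrt_le_iff.2 ⟨by positivity, ?_⟩
      rw [div_pow, Real.sq_sqrt (by positivity), Finset.sum_div]
      refine Finset.sum_le_sum fun i _ => ?_
      rw [div_pow, Real.norm_eq_abs, sq_abs]
      by_cases hi : v i = 0
      · simp [hi]
      · have := H t ht i hi
        gcongr
    rw [curveLength]
    calc _ ≤ ∫⁻ t in Icc (0 : ℝ) 1, ENNReal.ofReal (‖v‖ / w) := by
          refine setLIntegral_mono measurable_const fun t ht => ENNReal.ofReal_le_ofReal ?_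
          rw [hd]
          exact key t ht
      _ = _ := by simp

theorem abs_apply_le_hNorm {n : ℕ} {h : ℕ} (x : GSpace n) {i : Fin n} (hi : (i : ℕ) < h) :
    |x i| ≤ hNorm h x := by
  rw [← Real.sqrt_sq_eq_abs, hNorm]
  refine Real.sqrt_le_sqrt ?_
  have := Finset.single_le_sum (f := fun i : Fin n => if (i : ℕ) < h then x i ^ 2 else 0)
    (fun j _ => by positivity) (Finset.mem_univ i)
  simpa [hi] using this

theorem hNorm_le_of_forall_abs_sub_le {n : ℕ} {h : ℕ} {x y : GSpace n} {ρ : ℝ} (hρ : 0 ≤ ρ)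
    (H : ∀ i : Fin n, (i : ℕ) < h → |y i - x i| ≤ ρ) : hNorm h y ≤ hNorm h x + n * ρ := by
  -- `hNorm` is the norm of a coordinate projection, so it obeys the triangle inequality.
  let P : GSpace n → GSpace n := fun x => WithLp.toLp 2 fun i => if (i : ℕ) < h then x i else 0
  have hP : ∀ x, hNorm h x = ‖P x‖ := by
    intro x
    rw [hNorm, EuclideanSpace.norm_eq]
    congr 1
    refine Finset.sum_congr rfl fun i _ => ?_
    by_cases hi : (i : ℕ) < h <;> simp [P, hi]
  rw [hP, hP]
  have h1 : ‖P y - P x‖ ≤ n * ρ := by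
    rw [EuclideanSpace.norm_eq]
    refine Real.sqrt_le_iff.2 ⟨by positivity, ?_⟩
    calc ∑ i, ‖(P y - P x) i‖ ^ 2 ≤ ∑ i : Fin n, ρ ^ 2 := by
          refine Finset.sum_le_sum fun i _ => ?_
          by_cases hi : (i : ℕ) < h
          · simpa [P, hi] using pow_le_pow_left₀ (abs_nonneg _) (H i hi) 2
          · simpa [P, hi] using sq_nonneg ρ
      _ = n * ρ ^ 2 := by simp
      _ ≤ (n * ρ) ^ 2 := by
          rw [mul_pow]
          gcongr
          rcases Nat.eq_zero_or_pos n with h0 | h0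
          · simp [h0]
          · exact le_self_pow₀ (by exact_mod_cast h0) (by norm_num)
  have h2 := norm_le_norm_add_norm_sub' (P y) (P x)
  linarith

/-- Two points are joined by a detour through the region where all the fields are large. -/
theorem horizontallyJoined_detour {n : ℕ} {h m : ℕ} (hh : 1 ≤ h) (hhn : h ≤ n) (x y : GSpace n)
    {δ : ℝ} (hδ : ‖y - x‖ < δ) :
    HorizontallyJoined h m x y
      (ENNReal.ofReal (2 * δ + ‖y - x‖ / min 1 ((δ - ‖y - x‖) ^ m))) := by
  have hδ0 : 0 < δ := (norm_nonneg _).trans_lt hδ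
  let i₀ : Fin n := ⟨0, by omega⟩
  have hi₀ : (i₀ : ℕ) < h := by simp [i₀]; omega
  -- The sign makes the shift by `ε * δ` in the coordinate `i₀` lead away from the degenerate set
  -- `hNorm h = 0`.
  obtain ⟨ε, hε, hεx⟩ : ∃ ε : ℝ, |ε| = 1 ∧ 0 ≤ ε * x i₀ := by
    rcases le_total 0 (x i₀) with h0 | h0
    · exact ⟨1, by simp, by simpa⟩
    · exact ⟨-1, by simp, by linarith⟩
  set e : GSpace n := EuclideanSpace.single i₀ (ε * δ) with he
  have hne : ‖e‖ = δ := by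
    rw [he, PiLp.norm_single, Real.norm_eq_abs, abs_mul, hε, one_mul, abs_of_pos hδ0]
  have hseg : ∀ z : GSpace n, HorizontallyJoined h m z (z + e) (ENNReal.ofReal δ) := by
    intro z
    have := horizontallyJoined_segment (h := h) (m := m) z e one_pos fun t _ i hi => by
      have : i = i₀ := by
        by_contra hne
        simp [he, hne] at hi
      rw [grushinWeight, if_pos (this ▸ hi₀)]
    rwa [div_one, hne] at this
  -- On the shifted segment the coordinate `i₀` stays at least δ - ‖y - x‖ in absolute value, which
  -- bounds the degenerate weights below; the minimum with 1 covers the fields of weight one.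
  set w := min 1 ((δ - ‖y - x‖) ^ m) with hw
  have hw0 : 0 < w := lt_min one_pos (pow_pos (by linarith) m)
  have hmid : HorizontallyJoined h m (x + e) (x + e + (y - x)) (ENNReal.ofReal (‖y - x‖ / w)) := by
    refine horizontallyJoined_segment (x + e) (y - x) hw0 fun t ht i _ => ?_
    unfold grushinWeight
    split_ifs
    · exact min_le_left _ _
    · refine (min_le_right _ _).trans (pow_le_pow_left₀ (by linarith) ?_ m)
      refine le_trans ?_ (abs_apply_le_hNorm _ hi₀)
      have h1 : |(y - x) i₀| ≤ ‖y - x‖ := by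
        simpa [Real.norm_eq_abs] using PiLp.norm_apply_le (y - x) i₀
      have h2 : |t * (y - x) i₀| ≤ ‖y - x‖ := by
        rw [abs_mul, abs_of_nonneg ht.1]
        exact (mul_le_of_le_one_left (abs_nonneg _) ht.2).trans h1
      have h3 : (x + e + t • (y - x)) i₀ = x i₀ + ε * δ + t * (y - x) i₀ := by
        simp [he]
      have h4 : |(x + e + t • (y - x)) i₀| = |ε * (x + e + t • (y - x)) i₀| := by
        rw [abs_mul, hε, one_mul]
      have h5 : |ε * (t * (y - x) i₀)| ≤ ‖y - x‖ := by rwa [abs_mul, hε, one_mul]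
      have h6 : ε * ε = 1 := by rw [← abs_mul_abs_self, hε, one_mul]
      rw [h4, h3]
      refine le_trans ?_ (le_abs_self _)
      have h7 := (abs_le.1 h5).1
      have h8 : ε * (x i₀ + ε * δ + t * (y - x) i₀) =
        ε * x i₀ + (ε * ε) * δ + ε * (t * (y - x) i₀) := by ring
      rw [h8, h6]
      linarith
  have h9 : x + e + (y - x) = y + e := by abel
  rw [h9] at hmid
  have := ((hseg x).trans hmid).trans (hseg y).symm
  rw [← ENNReal.ofReal_add hδ0.le (by positivity),
    ← ENNReal.ofReal_add (by positivity) hδ0.le] at this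
  convert this using 2
  ring

/-! ### Displacement along a horizontal curve -/

theorem IsHorizontalCurve.absCont_apply {n : ℕ} {h m : ℕ} {x y : GSpace n} {γ : ℝ → GSpace n}
    (hγ : IsHorizontalCurve h m x y γ) (i : Fin n) :
    AbsolutelyContinuousOnInterval (fun t => γ t i) 0 1 := by
  have h1 := hγ.absCont
  rw [absolutelyContinuousOnInterval_iff] at h1 ⊢
  intro ε hε
  obtain ⟨δ, hδ, H⟩ := h1 ε hε
  refine ⟨δ, hδ, fun E hE hlt => lt_of_le_of_lt (Finset.sum_le_sum fun j _ => ?_) (H E hE hlt)⟩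
  rw [dist_eq_norm, dist_eq_norm]
  exact PiLp.norm_apply_le (γ (E.2 j).1 - γ (E.2 j).2) i

theorem IsHorizontalCurve.ae_deriv_apply {n : ℕ} {h m : ℕ} {x y : GSpace n} {γ : ℝ → GSpace n}
    (hγ : IsHorizontalCurve h m x y γ) :
    ∀ᵐ t, t ∈ Icc (0 : ℝ) 1 → ∀ i, deriv (fun t => γ t i) t = deriv γ t i := by
  have h1 : ∀ᵐ t, ∀ i, t ∈ uIcc (0 : ℝ) 1 → DifferentiableAt ℝ (fun t => γ t i) t :=
    ae_all_iff.2 fun i => (hγ.absCont_apply i).ae_differentiableAt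
  filter_upwards [h1] with t ht htI i
  rw [uIcc_of_le zero_le_one] at ht
  have h2 : DifferentiableAt ℝ γ t := differentiableAt_euclidean.2 fun i => ht i htI
  exact ((EuclideanSpace.proj i : GSpace n →L[ℝ] ℝ).hasFDerivAt.comp_hasDerivAt t
    h2.hasDerivAt).deriv

/-- Along a horizontal curve, a coordinate moves at most by the length of the curve times the
largest weight of the corresponding field. -/
theorem IsHorizontalCurve.abs_apply_sub_le {n : ℕ} {h m : ℕ} {x y : GSpace n}
    {γ : ℝ → GSpace n} (hγ : IsHorizontalCurve h m x y γ) {ℓ W : ℝ} (hℓ : 0 ≤ ℓ) (hW : 0 ≤ W)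
    (hL : curveLength h m γ ≤ ENNReal.ofReal ℓ) (i : Fin n)
    (hWi : ∀ t ∈ Icc (0 : ℝ) 1, grushinWeight h m (γ t) i ≤ W) {t : ℝ} (ht : t ∈ Icc (0 : ℝ) 1) :
    |γ t i - x i| ≤ W * ℓ := by
  have hac : AbsolutelyContinuousOnInterval (fun t => γ t i) 0 t := by
    refine (hγ.absCont_apply i).mono ?_
    rw [uIcc_of_le zero_le_one, uIcc_of_le ht.1]
    exact Icc_subset_Icc_right ht.2
  have h1 := hac.integral_deriv_eq_sub
  rw [hγ.source] at h1
  rw [← h1, ← ENNReal.ofReal_le_ofReal_iff (by positivity), ← Real.norm_eq_abs, ofReal_norm,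
    intervalIntegral.integral_of_le ht.1]
  have h2 := hγ.horizontal
  rw [ae_restrict_iff' measurableSet_Icc] at h2
  calc _ ≤ ∫⁻ s in Ioc 0 t, ‖deriv (fun t => γ t i) s‖ₑ := enorm_integral_le_lintegral_enorm _
    _ ≤ ∫⁻ s in Icc (0 : ℝ) 1, ‖deriv (fun t => γ t i) s‖ₑ :=
        lintegral_mono_set fun s hs => ⟨hs.1.le, hs.2.trans ht.2⟩
    _ ≤ ∫⁻ s in Icc (0 : ℝ) 1,
          ENNReal.ofReal W * ENNReal.ofReal (horizontalNorm h m (γ s) (deriv γ s)) := by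
        refine lintegral_mono_ae ?_
        rw [ae_restrict_iff' measurableSet_Icc]
        filter_upwards [h2, hγ.ae_deriv_apply] with s hs1 hs2 hs
        rw [hs2 hs i, ← ofReal_norm, Real.norm_eq_abs, ← ENNReal.ofReal_mul hW]
        refine ENNReal.ofReal_le_ofReal
          ((abs_apply_le_of_mem_horizontalSpace (hs1 hs) i).trans ?_)
        exact mul_le_mul_of_nonneg_right (hWi s hs) (horizontalNorm_nonneg _ _ _ _)
    _ = ENNReal.ofReal W * curveLength h m γ := lintegral_const_mul' _ _ ENNReal.ofReal_ne_top
    _ ≤ ENNReal.ofReal (W * ℓ) := by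
        rw [ENNReal.ofReal_mul hW]
        gcongr

/-! ### Finiteness, triangle inequality and continuity of the distance -/

/-- The Carnot–Carathéodory distance with values in `[0, ∞]`. -/
noncomputable def ccEDist {n : ℕ} (h m : ℕ) (x y : GSpace n) : ℝ≥0∞ :=
  ⨅ (γ : ℝ → GSpace n) (_ : IsHorizontalCurve h m x y γ), curveLength h m γ

theorem dC_eq_toReal {n : ℕ} (h m : ℕ) (x y : GSpace n) : dC h m x y = (ccEDist h m x y).toReal :=
  rfl

theorem HorizontallyJoined.ccEDist_le {n : ℕ} {h m : ℕ} {x y : GSpace n} {L : ℝ≥0∞}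
    (H : HorizontallyJoined h m x y L) : ccEDist h m x y ≤ L := by
  obtain ⟨γ, hγ, hL⟩ := H
  exact (iInf₂_le γ hγ).trans hL

theorem horizontallyJoined_of_ccEDist_lt {n : ℕ} {h m : ℕ} {x y : GSpace n} {L : ℝ≥0∞}
    (H : ccEDist h m x y < L) : HorizontallyJoined h m x y L := by
  obtain ⟨γ, hγ⟩ := iInf_lt_iff.1 H
  obtain ⟨hc, hL⟩ := iInf_lt_iff.1 hγ
  exact ⟨γ, hc, hL.le⟩

theorem ccEDist_comm {n : ℕ} (h m : ℕ) (x y : GSpace n) : ccEDist h m x y = ccEDist h m y x := by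
  have H : ∀ x y : GSpace n, ccEDist h m x y ≤ ccEDist h m y x := fun x y =>
    le_of_forall_gt fun L hL => by
      obtain ⟨L', h1, h2⟩ := exists_between hL
      exact ((horizontallyJoined_of_ccEDist_lt h1).symm.ccEDist_le).trans_lt h2
  exact le_antisymm (H x y) (H y x)

theorem ccEDist_triangle {n : ℕ} (h m : ℕ) (x y z : GSpace n) :
    ccEDist h m x z ≤ ccEDist h m x y + ccEDist h m y z := by
  refine ENNReal.le_of_forall_pos_le_add fun ε hε hfin => ?_
  have hε' : (ε / 2 : ℝ≥0∞) ≠ 0 := by simp [hε.ne']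
  have hx : ccEDist h m x y ≠ ⊤ := (lt_of_le_of_lt le_self_add hfin).ne
  have hy : ccEDist h m y z ≠ ⊤ := (lt_of_le_of_lt le_add_self hfin).ne
  have h1 := (horizontallyJoined_of_ccEDist_lt (ENNReal.lt_add_right hx hε')).trans
    (horizontallyJoined_of_ccEDist_lt (ENNReal.lt_add_right hy hε'))
  refine h1.ccEDist_le.trans (le_of_eq ?_)
  rw [add_add_add_comm, ENNReal.add_halves]

/-- The detour with δ = ‖y - x‖ + 1 has finite length. Without finiteness `toReal` would send ∞ to 0
and the real-valued distance could lose the triangle inequality. -/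
theorem ccEDist_ne_top {n : ℕ} {h : ℕ} (hh : 1 ≤ h) (hhn : h ≤ n) (m : ℕ) (x y : GSpace n) :
    ccEDist h m x y ≠ ⊤ :=
  ((horizontallyJoined_detour hh hhn x y (lt_add_one _)).ccEDist_le.trans_lt
    ENNReal.ofReal_lt_top).ne

theorem dC_nonneg {n : ℕ} (h m : ℕ) (x y : GSpace n) : 0 ≤ dC h m x y := ENNReal.toReal_nonneg

theorem dC_comm {n : ℕ} (h m : ℕ) (x y : GSpace n) : dC h m x y = dC h m y x := by
  rw [dC_eq_toReal, dC_eq_toReal, ccEDist_comm]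

theorem dC_triangle {n : ℕ} {h : ℕ} (hh : 1 ≤ h) (hhn : h ≤ n) (m : ℕ) (x y z : GSpace n) :
    dC h m x z ≤ dC h m x y + dC h m y z := by
  rw [dC_eq_toReal, dC_eq_toReal, dC_eq_toReal,
    ← ENNReal.toReal_add (ccEDist_ne_top hh hhn m x y) (ccEDist_ne_top hh hhn m y z)]
  exact ENNReal.toReal_mono (ENNReal.add_ne_top.2
    ⟨ccEDist_ne_top hh hhn m x y, ccEDist_ne_top hh hhn m y z⟩) (ccEDist_triangle h m x y z)

theorem HorizontallyJoined.dC_le {n : ℕ} {h m : ℕ} {x y : GSpace n} {L : ℝ} (hL : 0 ≤ L)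
    (H : HorizontallyJoined h m x y (ENNReal.ofReal L)) : dC h m x y ≤ L := by
  rw [dC_eq_toReal, ← ENNReal.toReal_ofReal hL]
  exact ENNReal.toReal_mono ENNReal.ofReal_ne_top H.ccEDist_le

theorem horizontallyJoined_of_dC_lt {n : ℕ} {h : ℕ} (hh : 1 ≤ h) (hhn : h ≤ n) {m : ℕ}
    {x y : GSpace n} {L : ℝ} (H : dC h m x y < L) :
    HorizontallyJoined h m x y (ENNReal.ofReal L) := by
  refine horizontallyJoined_of_ccEDist_lt ?_
  rw [← ENNReal.ofReal_toReal (ccEDist_ne_top hh hhn m x y)]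
  exact (ENNReal.ofReal_lt_ofReal_iff ((dC_nonneg h m x y).trans_lt H)).2 H

theorem tendsto_dC_nhds_zero {n : ℕ} {h : ℕ} (hh : 1 ≤ h) (hhn : h ≤ n) (m : ℕ) (x : GSpace n) :
    Filter.Tendsto (fun y => dC h m x y) (nhds x) (nhds 0) := by
  refine tendsto_order.2 ⟨fun a ha => Filter.Eventually.of_forall fun y =>
    ha.trans_le (dC_nonneg h m x y), fun ε hε => ?_⟩
  -- The detour size stays fixed at ε/4 while y tends to x: the two shifts cost ε/2 together, and
  -- the cost of the middle segment tends to 0.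
  have hδ : 0 < ε / 4 := by positivity
  have hmin : min 1 ((ε / 4 - ‖x - x‖) ^ m) ≠ 0 := by
    rw [sub_self, norm_zero, sub_zero]
    exact (lt_min one_pos (pow_pos hδ m)).ne'
  have h1 : ContinuousAt
      (fun y : GSpace n => 2 * (ε / 4) + ‖y - x‖ / min 1 ((ε / 4 - ‖y - x‖) ^ m)) x := by
    refine continuousAt_const.add (ContinuousAt.div ?_ ?_ hmin)
    · fun_prop
    · exact Continuous.continuousAt (by fun_prop)
  have h2 := h1.tendsto
  rw [sub_self, norm_zero, zero_div, add_zero] at h2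
  have h3 : ∀ᶠ y : GSpace n in nhds x, ‖y - x‖ < ε / 4 := by
    filter_upwards [Metric.ball_mem_nhds x hδ] with y hy
    rwa [← dist_eq_norm]
  filter_upwards [h2.eventually_lt_const (show 2 * (ε / 4) < ε by linarith), h3] with y hy1 hy2
  refine lt_of_le_of_lt ((horizontallyJoined_detour hh hhn x y hy2).dC_le ?_) hy1
  have : 0 ≤ min 1 ((ε / 4 - ‖y - x‖) ^ m) :=
    le_min zero_le_one (pow_nonneg (by linarith) m)
  positivity

theorem continuous_dC {n : ℕ} {h : ℕ} (hh : 1 ≤ h) (hhn : h ≤ n) (m : ℕ) :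
    Continuous fun z : GSpace n × GSpace n => dC h m z.1 z.2 := by
  rw [continuous_iff_continuousAt]
  rintro ⟨x, y⟩
  rw [ContinuousAt, tendsto_iff_dist_tendsto_zero]
  have h1 : Filter.Tendsto (fun z : GSpace n × GSpace n => dC h m x z.1 + dC h m y z.2)
      (nhds (x, y)) (nhds (0 + 0)) := by
    rw [nhds_prod_eq]
    exact ((tendsto_dC_nhds_zero hh hhn m x).comp Filter.tendsto_fst).add
      ((tendsto_dC_nhds_zero hh hhn m y).comp Filter.tendsto_snd)
  rw [add_zero] at h1
  refine squeeze_zero (fun _ => dist_nonneg) (fun z => ?_) h1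
  rw [Real.dist_eq, abs_le]
  have t1 := dC_triangle hh hhn m x z.1 y
  have t2 := dC_triangle hh hhn m z.1 z.2 y
  have t3 := dC_triangle hh hhn m z.1 x z.2
  have t4 := dC_triangle hh hhn m x y z.2
  have c1 := dC_comm h m z.2 y
  have c2 := dC_comm h m z.1 x
  constructor <;> simp only <;> linarith

theorem measurable_dC {n : ℕ} {h : ℕ} (hh : 1 ≤ h) (hhn : h ≤ n) (m : ℕ) :
    Measurable fun z : GSpace n × GSpace n => dC h m z.1 z.2 :=
  (continuous_dC hh hhn m).measurable

theorem isOpen_ccBall {n : ℕ} {h : ℕ} (hh : 1 ≤ h) (hhn : h ≤ n) (m : ℕ) (x : GSpace n) (r : ℝ) :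
    IsOpen (ccBall h m x r) :=
  isOpen_lt ((continuous_dC hh hhn m).comp (continuous_id.prodMk continuous_const))
    continuous_const

/-! ### Balls lie in boxes; volume of balls -/

/-- Every coordinate of two points at distance less than `ρ` differs by a controlled amount. -/
theorem abs_apply_sub_le_of_dC_lt {n : ℕ} {h : ℕ} (hh : 1 ≤ h) (hhn : h ≤ n) {m : ℕ}
    {x y : GSpace n} {ρ : ℝ} (H : dC h m x y < ρ) :
    (∀ i : Fin n, (i : ℕ) < h → |y i - x i| ≤ ρ) ∧
      (∀ i : Fin n, ¬ (i : ℕ) < h → |y i - x i| ≤ (hNorm h x + n * ρ) ^ m * ρ) := by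
  have hρ : 0 ≤ ρ := (dC_nonneg h m x y).trans H.le
  obtain ⟨γ, hγ, hL⟩ := horizontallyJoined_of_dC_lt hh hhn H
  -- The coordinates of weight one are bounded along the whole curve, not only at its end, because
  -- this controls `hNorm` and hence the remaining weights at every time.
  have h1 : ∀ i : Fin n, (i : ℕ) < h → ∀ t ∈ Icc (0 : ℝ) 1, |γ t i - x i| ≤ ρ := by
    intro i hi t ht
    have := hγ.abs_apply_sub_le hρ zero_le_one hL i
      (fun s _ => by rw [grushinWeight, if_pos hi]) ht
    rwa [one_mul] at this
  have hend : (1 : ℝ) ∈ Icc (0 : ℝ) 1 := by simp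
  refine ⟨fun i hi => by simpa only [hγ.target] using h1 i hi 1 hend, fun i hi => ?_⟩
  have := hγ.abs_apply_sub_le hρ
    (pow_nonneg (add_nonneg (hNorm_nonneg h x) (by positivity : (0 : ℝ) ≤ n * ρ)) m) hL i
    (fun s hs => by
      rw [grushinWeight, if_neg hi]
      exact pow_le_pow_left₀ (hNorm_nonneg h _)
        (hNorm_le_of_forall_abs_sub_le hρ fun j hj => h1 j hj s hs) m) hend
  simpa only [hγ.target] using this

theorem hNorm_le_of_dC_lt {n : ℕ} {h : ℕ} (hh : 1 ≤ h) (hhn : h ≤ n) {m : ℕ}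
    {x y : GSpace n} {ρ : ℝ} (H : dC h m x y < ρ) : hNorm h y ≤ hNorm h x + n * ρ :=
  hNorm_le_of_forall_abs_sub_le ((dC_nonneg h m x y).trans H.le)
    (abs_apply_sub_le_of_dC_lt hh hhn H).1

/-- A straight move along a coordinate of weight one is length-minimising, since that coordinate
cannot change by more than the length of a curve. Such points at every distance turn an inclusion of
concentric balls into an inequality of radii. -/
theorem exists_dC_eq {n : ℕ} {h : ℕ} (hh : 1 ≤ h) (hhn : h ≤ n) (m : ℕ) (x : GSpace n) {ρ : ℝ}
    (hρ : 0 ≤ ρ) : ∃ y, dC h m y x = ρ := by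
  let i₀ : Fin n := ⟨0, by omega⟩
  have hi₀ : (i₀ : ℕ) < h := by simp [i₀]; omega
  set e : GSpace n := EuclideanSpace.single i₀ ρ with he
  refine ⟨x + e, ?_⟩
  rw [dC_comm]
  apply le_antisymm
  · have := horizontallyJoined_segment (h := h) (m := m) x e one_pos fun t _ i hi => by
      have : i = i₀ := by
        by_contra hne
        simp [he, hne] at hi
      rw [grushinWeight, if_pos (this ▸ hi₀)]
    rw [div_one, he, PiLp.norm_single, Real.norm_eq_abs, abs_of_nonneg hρ] at this
    exact this.dC_le hρ
  · by_contra hlt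
    obtain ⟨ρ', h1, h2⟩ := exists_between (not_le.1 hlt)
    have := (abs_apply_sub_le_of_dC_lt hh hhn h1).1 i₀ hi₀
    simp [he, abs_of_nonneg hρ] at this
    linarith

theorem le_of_ccBall_subset {n : ℕ} {h : ℕ} (hh : 1 ≤ h) (hhn : h ≤ n) {m : ℕ} {x : GSpace n}
    {r ρ : ℝ} (hρ : 0 ≤ ρ) (H : ccBall h m x r ⊆ ccBall h m x ρ) : r ≤ ρ := by
  by_contra hlt
  obtain ⟨y, hy⟩ := exists_dC_eq hh hhn m x hρ
  have h1 : y ∈ ccBall h m x ρ := H (show dC h m y x < r by rw [hy]; exact not_le.1 hlt)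
  exact lt_irrefl _ (hy ▸ h1 : ρ < ρ)

/-- The displacement bounds enclose the ball in a box; each of the n - h degenerate coordinates
contributes an extra factor (|x|_h + nρ)^m to its volume. -/
theorem volume_ccBall_le {n : ℕ} {h : ℕ} (hh : 1 ≤ h) (hhn : h ≤ n) (m : ℕ) (x : GSpace n)
    {ρ : ℝ} (hρ : 0 ≤ ρ) :
    volume (ccBall h m x ρ) ≤
      ENNReal.ofReal (2 ^ n * ρ ^ n * (hNorm h x + n * ρ) ^ (m * (n - h))) := by
  have hN : 0 ≤ hNorm h x + n * ρ := add_nonneg (hNorm_nonneg h x) (by positivity)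
  let b : Fin n → ℝ := fun i => if (i : ℕ) < h then ρ else (hNorm h x + n * ρ) ^ m * ρ
  have hb : ∀ i, 0 ≤ b i := fun i => by
    simp only [b]; split_ifs <;> positivity
  have hsub : ccBall h m x ρ ⊆ (WithLp.ofLp : GSpace n → (Fin n → ℝ)) ⁻¹'
      (Icc (fun i => x i - b i) (fun i => x i + b i)) := by
    intro y hy
    have hy' : dC h m x y < ρ := by rw [dC_comm]; exact hy
    have h1 : ∀ i, |y i - x i| ≤ b i := by
      intro i
      by_cases hi : (i : ℕ) < h
      · simpa [b, hi] using (abs_apply_sub_le_of_dC_lt hh hhn hy').1 i hi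
      · simpa [b, hi] using (abs_apply_sub_le_of_dC_lt hh hhn hy').2 i hi
    exact ⟨fun i => by have := (abs_le.1 (h1 i)).1; simp only; linarith,
      fun i => by have := (abs_le.1 (h1 i)).2; simp only; linarith⟩
  refine (measure_mono hsub).trans ?_
  rw [(PiLp.volume_preserving_ofLp (Fin n)).measure_preimage measurableSet_Icc.nullMeasurableSet,
    Real.volume_Icc_pi, ← ENNReal.ofReal_prod_of_nonneg (fun i _ => by linarith [hb i])]
  refine ENNReal.ofReal_le_ofReal (le_of_eq ?_)
  have h2 : ∀ i : Fin n, x i + b i - (x i - b i) =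
      2 * ρ * (if (i : ℕ) < h then 1 else (hNorm h x + n * ρ) ^ m) := by
    intro i
    simp only [b]; split_ifs <;> ring
  rw [Finset.prod_congr rfl fun i _ => h2 i, Finset.prod_mul_distrib, Finset.prod_ite]
  have h3 : (Finset.univ.filter fun i : Fin n => ¬ (i : ℕ) < h).card = n - h := by
    have h4 := Finset.card_filter_add_card_filter_not
      (s := (Finset.univ : Finset (Fin n))) (fun i : Fin n => (i : ℕ) < h)
    rw [Finset.card_univ, Fintype.card_fin, Fin.card_filter_val_lt, min_eq_right hhn] at h4
    omega
  rw [Finset.prod_const, Finset.prod_const_one, Finset.prod_const, h3, Finset.card_univ,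
    Fintype.card_fin, one_mul, mul_pow, pow_mul]

/-! ### The truncated kernel integral by dyadic annuli -/

theorem gKernel_nonneg {n : ℕ} (h m : ℕ) (s p : ℝ) (x y : GSpace n) : 0 ≤ gKernel h m s p x y :=
  Real.rpow_nonneg (dC_nonneg h m x y) _

theorem gKernel_comm {n : ℕ} (h m : ℕ) (s p : ℝ) (x y : GSpace n) :
    gKernel h m s p x y = gKernel h m s p y x := by
  rw [gKernel, gKernel, dC_comm]

theorem measurable_gKernel {n : ℕ} {h : ℕ} (hh : 1 ≤ h) (hhn : h ≤ n) (m : ℕ) (s p : ℝ) :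
    Measurable fun z : GSpace n × GSpace n => gKernel h m s p z.1 z.2 :=
  (measurable_dC hh hhn m).pow_const _

/-- The weight of the `k`-th dyadic annulus. -/
noncomputable def dyadicWeight (n h m : ℕ) (s p : ℝ) (k : ℤ) : ℝ :=
  ((2 : ℝ) ^ k) ^ (-(homDim n h m : ℝ) - s * p) * min 1 ((2 : ℝ) ^ (k + 2)) ^ p *
    ((2 : ℝ) ^ (k + 1)) ^ n * max 1 ((2 : ℝ) ^ (k + 1)) ^ (m * (n - h))

theorem dyadicWeight_nonneg (n h m : ℕ) (s p : ℝ) (k : ℤ) : 0 ≤ dyadicWeight n h m s p k := by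
  unfold dyadicWeight
  positivity

/-- Both ends are geometric. For k = j ≥ 0 the volume factors of total degree Q cancel against the
kernel and leave the ratio 2^{-sp}. For k = -(j+1) the volume gives only degree n and the truncation
gives p, so the ratio is 2^{sp + m(n-h) - p}, which is below 1 by `hspm`. -/
theorem summable_dyadicWeight {n h m : ℕ} {s p : ℝ} (hp : 0 ≤ p) (hsp : 0 < s * p)
    (hspm : s * p + (m * (n - h) : ℕ) < p) : Summable (dyadicWeight n h m s p) := by
  have hQ : (homDim n h m : ℝ) = n + (m * (n - h) : ℕ) := by
    rw [homDim]; push_cast; rfl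
  refine Summable.of_nat_of_neg_add_one ?_ ?_
  · have hg : Summable fun j : ℕ => (2 : ℝ) ^ n * 2 ^ (m * (n - h)) * ((2 : ℝ) ^ (-(s * p))) ^ j :=
      (summable_geometric_of_lt_one (by positivity)
        (Real.rpow_lt_one_of_one_lt_of_neg one_lt_two (by linarith))).mul_left _
    refine Summable.of_nonneg_of_le (fun j => dyadicWeight_nonneg _ _ _ _ _ _) (fun j => ?_) hg
    have hT : (0 : ℝ) < 2 ^ j := by positivity
    have e1 : (2 : ℝ) ^ ((j : ℤ) + 1) = 2 * 2 ^ j := by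
      rw [zpow_add₀ two_ne_zero, zpow_natCast, zpow_one, mul_comm]
    have e2 : max 1 ((2 : ℝ) * 2 ^ j) = 2 * 2 ^ j :=
      max_eq_right (by have := one_le_pow₀ (n := j) (one_le_two (α := ℝ)); linarith)
    have e3 : ((2 : ℝ) ^ j) ^ (-(homDim n h m : ℝ) - s * p) =
        ((2 : ℝ) ^ j) ^ (-(s * p)) * (((2 : ℝ) ^ j) ^ n * ((2 : ℝ) ^ j) ^ (m * (n - h)))⁻¹ := by
      rw [← pow_add, ← Real.rpow_natCast _ (n + m * (n - h)), ← Real.rpow_neg hT.le,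
        ← Real.rpow_add hT, hQ]
      push_cast
      ring_nf
    have e4 : min (1 : ℝ) (2 ^ ((j : ℤ) + 2)) ^ p ≤ 1 :=
      Real.rpow_le_one (by positivity) (min_le_left _ _) hp
    rw [dyadicWeight, e1, e2, zpow_natCast, e3, ← Real.rpow_pow_comm two_pos.le]
    calc _ ≤ ((2 : ℝ) ^ (-(s * p))) ^ j *
            (((2 : ℝ) ^ j) ^ n * ((2 : ℝ) ^ j) ^ (m * (n - h)))⁻¹ * 1 *
            (2 * 2 ^ j) ^ n * (2 * 2 ^ j) ^ (m * (n - h)) := by gcongr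
      _ = _ := by rw [mul_pow, mul_pow]; field_simp
  · have hg : Summable fun j : ℕ => (2 : ℝ) ^ ((homDim n h m : ℝ) + s * p) * 2 ^ p *
        ((2 : ℝ) ^ (s * p + (m * (n - h) : ℕ) - p)) ^ j :=
      (summable_geometric_of_lt_one (by positivity)
        (Real.rpow_lt_one_of_one_lt_of_neg one_lt_two (by linarith))).mul_left _
    refine Summable.of_nonneg_of_le (fun j => dyadicWeight_nonneg _ _ _ _ _ _) (fun j => ?_) hg
    have hU : (0 : ℝ) < 2 ^ j := by positivity
    have e0 : (2 : ℝ) ^ (-((j : ℤ) + 1)) = (2 * 2 ^ j)⁻¹ := by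
      rw [zpow_neg, zpow_add₀ two_ne_zero, zpow_natCast, zpow_one, mul_comm]
    have e1 : (2 : ℝ) ^ (-((j : ℤ) + 1) + 1) = (2 ^ j)⁻¹ := by
      rw [neg_add, neg_add_cancel_right, zpow_neg, zpow_natCast]
    have e2 : (2 : ℝ) ^ (-((j : ℤ) + 1) + 2) = 2 * (2 ^ j)⁻¹ := by
      rw [show -((j : ℤ) + 1) + 2 = -(j : ℤ) + 1 by ring, zpow_add₀ two_ne_zero, zpow_neg,
        zpow_natCast, zpow_one, mul_comm]
    have e3 : max 1 (((2 : ℝ) ^ j)⁻¹) = 1 :=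
      max_eq_left (inv_le_one_of_one_le₀ (one_le_pow₀ one_le_two))
    have e4 : ((2 : ℝ) ^ j) ^ (s * p + (m * (n - h) : ℕ) - p) =
        ((2 : ℝ) ^ j) ^ ((homDim n h m : ℝ) + s * p) * (((2 : ℝ) ^ j)⁻¹) ^ p * ((2 ^ j)⁻¹) ^ n := by
      rw [Real.inv_rpow hU.le, ← Real.rpow_neg hU.le, inv_pow, ← Real.rpow_natCast _ n,
        ← Real.rpow_neg hU.le, ← Real.rpow_add hU, ← Real.rpow_add hU, hQ]
      ring_nf
    rw [dyadicWeight, e0, e1, e2, e3, one_pow, mul_one, Real.rpow_pow_comm two_pos.le, e4,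
      Real.inv_rpow (by positivity), ← Real.rpow_neg (by positivity), neg_sub, sub_neg_eq_add,
      add_comm (s * p), Real.mul_rpow two_pos.le hU.le]
    calc _ ≤ (2 : ℝ) ^ ((homDim n h m : ℝ) + s * p) * (2 ^ j) ^ ((homDim n h m : ℝ) + s * p) *
            (2 * (2 ^ j)⁻¹) ^ p * ((2 ^ j)⁻¹) ^ n := by
          gcongr
          exact min_le_right _ _
      _ = _ := by
          rw [Real.mul_rpow two_pos.le (by positivity)]
          ring

theorem gKernel_mul_min_le_tsum {n h m : ℕ} {s p : ℝ} (hp : 0 ≤ p) (hsp : 0 < s * p)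
    (x y : GSpace n) {r : ℝ} (hr : 0 < r) :
    ENNReal.ofReal (gKernel h m s p x y * min 1 (2 * dC h m x y / r) ^ p) ≤
      ∑' k : ℤ, (ccBall h m x (2 ^ (k + 1) * r)).indicator
        (fun _ => ENNReal.ofReal ((2 ^ k * r) ^ (-(homDim n h m : ℝ) - s * p) *
          min 1 (2 ^ (k + 2)) ^ p)) y := by
  have hneg : -(homDim n h m : ℝ) - s * p < 0 := by
    have : (0 : ℝ) ≤ homDim n h m := Nat.cast_nonneg _
    linarith
  -- At distance 0 the kernel is 0 to a nonzero power, which is 0 by convention, so this case needs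
  -- no annulus.
  rcases (dC_nonneg h m x y).eq_or_lt with h0 | h0
  · rw [gKernel, ← h0, Real.zero_rpow hneg.ne]
    simp
  obtain ⟨k, hk1, hk2⟩ := exists_mem_Ico_zpow (div_pos h0 hr) one_lt_two
  rw [le_div_iff₀ hr] at hk1
  have hk2' := hk2
  rw [div_lt_iff₀ hr] at hk2'
  -- The annulus of y is bounded by the full outer ball: the kernel is evaluated at the inner
  -- radius, the truncation at the outer one.
  refine le_trans ?_ (ENNReal.le_tsum k)
  rw [indicator_of_mem (show y ∈ ccBall h m x (2 ^ (k + 1) * r) from by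
    rw [ccBall, mem_ofPred_eq, dC_comm]; exact hk2')]
  refine ENNReal.ofReal_le_ofReal ?_
  rw [gKernel]
  have e : (2 : ℝ) ^ (k + 2) = 2 * 2 ^ (k + 1) := by
    rw [show k + 2 = (k + 1) + 1 by ring, zpow_add_one₀ two_ne_zero, mul_comm]
  refine mul_le_mul (Real.rpow_le_rpow_of_nonpos (by positivity) hk1 hneg.le) ?_
    (by positivity) (by positivity)
  refine Real.rpow_le_rpow (le_min zero_le_one (by positivity)) ?_ hp
  rw [e, mul_div_assoc]
  gcongr

/-- The basic kernel estimate: the integral of the kernel, truncated at the scale `r`. -/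
theorem exists_lintegral_gKernel_mul_min_le {n h m : ℕ} (hh : 1 ≤ h) (hhn : h ≤ n) {s p : ℝ}
    (hp : 0 ≤ p) (hsp : 0 < s * p) (hspm : s * p + (m * (n - h) : ℕ) < p) :
    ∃ C : ℝ, 0 < C ∧ ∀ (x : GSpace n) (r : ℝ), 0 < r →
      ∫⁻ y, ENNReal.ofReal (gKernel h m s p x y * min 1 (2 * dC h m x y / r) ^ p) ≤
        ENNReal.ofReal (C * r ^ ((n : ℝ) - homDim n h m - s * p) *
          (hNorm h x + r) ^ (m * (n - h))) := by
  have hsum := summable_dyadicWeight hp hsp hspm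
  set S := ∑' k, dyadicWeight n h m s p k with hS
  have hS0 : 0 ≤ S := tsum_nonneg fun k => dyadicWeight_nonneg _ _ _ _ _ _
  have hn1 : (1 : ℝ) ≤ n := by exact_mod_cast hh.trans hhn
  -- `S + 1` in place of `S` makes positivity of the constant immediate.
  refine ⟨2 ^ n * n ^ (m * (n - h)) * (S + 1), by positivity, fun x r hr => ?_⟩
  have hN := hNorm_nonneg h x
  set A : ℝ := 2 ^ n * n ^ (m * (n - h)) * r ^ ((n : ℝ) - homDim n h m - s * p) *
    (hNorm h x + r) ^ (m * (n - h)) with hA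
  have hA0 : 0 ≤ A := by positivity
  have hterm : ∀ k : ℤ, ENNReal.ofReal ((2 ^ k * r) ^ (-(homDim n h m : ℝ) - s * p) *
      min 1 (2 ^ (k + 2)) ^ p) * volume (ccBall h m x (2 ^ (k + 1) * r)) ≤
        ENNReal.ofReal (A * dyadicWeight n h m s p k) := by
    intro k
    refine (mul_le_mul_right (volume_ccBall_le hh hhn m x (by positivity)) _).trans ?_
    rw [← ENNReal.ofReal_mul (by positivity)]
    refine ENNReal.ofReal_le_ofReal ?_
    -- This separates the dependence on k from that on x and r, so that a single series serves every
    -- center and scale.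
    have h1 : hNorm h x + n * (2 ^ (k + 1) * r) ≤
        n * max 1 (2 ^ (k + 1)) * (hNorm h x + r) := by
      have a1 : hNorm h x ≤ n * max 1 (2 ^ (k + 1)) * hNorm h x :=
        le_mul_of_one_le_left hN (one_le_mul_of_one_le_of_one_le hn1 (le_max_left _ _))
      have a2 : (n : ℝ) * (2 ^ (k + 1) * r) ≤ n * max 1 (2 ^ (k + 1)) * r := by
        rw [mul_assoc]
        gcongr
        exact le_max_right _ _
      linarith
    have e1 : r ^ ((n : ℝ) - homDim n h m - s * p) =
        r ^ n * r ^ (-(homDim n h m : ℝ) - s * p) := by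
      rw [← Real.rpow_natCast r n, ← Real.rpow_add hr]
      ring_nf
    have h0 : 0 ≤ hNorm h x + n * (2 ^ (k + 1) * r) := by positivity
    calc _ ≤ (2 ^ k * r) ^ (-(homDim n h m : ℝ) - s * p) * min 1 (2 ^ (k + 2)) ^ p *
          (2 ^ n * (2 ^ (k + 1) * r) ^ n *
            (n * max 1 (2 ^ (k + 1)) * (hNorm h x + r)) ^ (m * (n - h))) := by
          gcongr
      _ = _ := by
          rw [hA, e1, dyadicWeight, Real.mul_rpow (by positivity) hr.le, mul_pow, mul_pow, mul_pow]
          ring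
  calc _ ≤ ∫⁻ y, ∑' k : ℤ, (ccBall h m x (2 ^ (k + 1) * r)).indicator
        (fun _ => ENNReal.ofReal ((2 ^ k * r) ^ (-(homDim n h m : ℝ) - s * p) *
          min 1 (2 ^ (k + 2)) ^ p)) y :=
        lintegral_mono fun y => gKernel_mul_min_le_tsum hp hsp x y hr
    _ = ∑' k : ℤ, ENNReal.ofReal ((2 ^ k * r) ^ (-(homDim n h m : ℝ) - s * p) *
          min 1 (2 ^ (k + 2)) ^ p) * volume (ccBall h m x (2 ^ (k + 1) * r)) := by
        rw [lintegral_tsum fun k => (measurable_const.indicator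
          (isOpen_ccBall hh hhn m x _).measurableSet).aemeasurable]
        refine tsum_congr fun k => ?_
        rw [lintegral_indicator_const (isOpen_ccBall hh hhn m x _).measurableSet]
    _ ≤ ∑' k : ℤ, ENNReal.ofReal (A * dyadicWeight n h m s p k) := ENNReal.tsum_le_tsum hterm
    _ = ENNReal.ofReal (A * S) := by
        rw [← ENNReal.ofReal_tsum_of_nonneg
          (fun k => mul_nonneg hA0 (dyadicWeight_nonneg _ _ _ _ _ _)) (hsum.mul_left A),
          tsum_mul_left]
    _ ≤ _ := by
        refine ENNReal.ofReal_le_ofReal ?_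
        calc A * S ≤ A * (S + 1) := by gcongr; linarith
          _ = _ := by rw [hA]; ring

/-! ### Elementary inequalities behind the logarithmic estimate -/

theorem abs_rpow_sub_two_mul_self {p x : ℝ} (hp : 1 < p) (hx : 0 ≤ x) :
    |x| ^ (p - 2) * x = x ^ (p - 1) := by
  rcases hx.eq_or_lt with rfl | h0
  · rw [mul_zero, Real.zero_rpow (by linarith)]
  · rw [abs_of_pos h0]
    nth_rw 2 [← Real.rpow_one x]
    rw [← Real.rpow_add h0]
    ring_nf

/-- Bernoulli's inequality in the form `1 - t^{1-p} ≥ (p - 1) t^{-p} (t - 1)`. -/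
theorem mul_sub_one_le_one_sub_rpow {p t : ℝ} (hp : 1 < p) (ht : 1 ≤ t) :
    (p - 1) * t ^ (-p) * (t - 1) ≤ 1 - t ^ (1 - p) := by
  have ht0 : 0 < t := by linarith
  have h1 := one_add_mul_self_le_rpow_one_add (s := t - 1) (by linarith) hp.le
  rw [add_sub_cancel] at h1
  have h2 : t ^ (1 - p) = t * t ^ (-p) := by
    rw [sub_eq_add_neg, Real.rpow_add ht0, Real.rpow_one]
  have h3 : t ^ (-p) * t ^ p = 1 := by rw [← Real.rpow_add ht0]; simp
  have h4 := mul_le_mul_of_nonneg_left h1 (Real.rpow_nonneg ht0.le (-p))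
  rw [h3] at h4
  rw [h2]
  linarith

/-- For t ≤ 2, log t ≤ t - 1 and Bernoulli bounds the last factor below by a multiple of t - 1, so
both sides compare with (t-1)^p. For t ≥ 2 the right side is of order t^{p-1}, which dominates every
power of the logarithm. -/
theorem exists_log_rpow_le {p : ℝ} (hp : 1 < p) :
    ∃ c : ℝ, 0 < c ∧ ∀ t : ℝ, 1 ≤ t →
      c * Real.log t ^ p ≤ (t - 1) ^ (p - 1) * (1 - t ^ (1 - p)) := by
  -- This exponent turns log t ≤ t^q / q into a bound of (log t)^p by t^{p-1}.
  set q := (p - 1) / p with hq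
  have hq0 : 0 < q := div_pos (by linarith) (by linarith)
  set c₁ := (p - 1) * (2 : ℝ) ^ (-p) with hc₁
  set c₂ := (2 : ℝ)⁻¹ ^ (p - 1) * (1 - 2 ^ (1 - p)) * q ^ p with hc₂
  have h2p : (2 : ℝ) ^ (1 - p) < 1 :=
    Real.rpow_lt_one_of_one_lt_of_neg one_lt_two (by linarith)
  have hc₁0 : 0 < c₁ := mul_pos (by linarith) (by positivity)
  have hc₂0 : 0 < c₂ := mul_pos (mul_pos (by positivity) (by linarith)) (by positivity)
  refine ⟨min c₁ c₂, lt_min hc₁0 hc₂0, fun t ht => ?_⟩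
  have ht0 : 0 < t := by linarith
  have hlog : 0 ≤ Real.log t := Real.log_nonneg ht
  rcases le_total t 2 with h2 | h2
  · have a1 : Real.log t ≤ t - 1 := Real.log_le_sub_one_of_pos ht0
    have a2 : (t - 1) ^ p = (t - 1) ^ (p - 1) * (t - 1) := by
      rcases ht.eq_or_lt with rfl | h1
      · rw [sub_self, mul_zero, Real.zero_rpow (by linarith)]
      · rw [← Real.rpow_add_one (by linarith), sub_add_cancel]
    calc min c₁ c₂ * Real.log t ^ p ≤ c₁ * (t - 1) ^ p := by
          gcongr
          · exact min_le_left _ _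
      _ = (t - 1) ^ (p - 1) * ((p - 1) * (2 : ℝ) ^ (-p) * (t - 1)) := by rw [a2]; ring
      _ ≤ (t - 1) ^ (p - 1) * ((p - 1) * t ^ (-p) * (t - 1)) := by
          have a3 : (2 : ℝ) ^ (-p) ≤ t ^ (-p) :=
            Real.rpow_le_rpow_of_nonpos ht0 h2 (by linarith)
          have a4 : 0 ≤ t - 1 := by linarith
          have a5 : 0 ≤ p - 1 := by linarith
          gcongr
      _ ≤ _ := by
          exact mul_le_mul_of_nonneg_left (mul_sub_one_le_one_sub_rpow hp ht)
            (Real.rpow_nonneg (by linarith) _)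
  · have a1 : Real.log t ≤ t ^ q / q := Real.log_le_rpow_div ht0.le hq0
    have a2 : Real.log t ^ p ≤ t ^ (p - 1) / q ^ p := by
      calc Real.log t ^ p ≤ (t ^ q / q) ^ p := by gcongr
        _ = _ := by
          rw [Real.div_rpow (by positivity) hq0.le, ← Real.rpow_mul ht0.le, hq,
            div_mul_cancel₀ _ (by linarith : p ≠ 0)]
    have a3 : t ^ (1 - p) ≤ 2 ^ (1 - p) := Real.rpow_le_rpow_of_nonpos two_pos h2 (by linarith)
    calc min c₁ c₂ * Real.log t ^ p ≤ c₂ * (t ^ (p - 1) / q ^ p) := by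
          gcongr
          exact min_le_right _ _
      _ = (2⁻¹ * t) ^ (p - 1) * (1 - 2 ^ (1 - p)) := by
          rw [hc₂, Real.mul_rpow (by positivity) ht0.le]
          field_simp
      _ ≤ _ := by
          gcongr
          · linarith

theorem rpow_sub_rpow_le {p α β : ℝ} (hp : 1 < p) (hβ : 0 ≤ β) (hαβ : β ≤ α) :
    α ^ p - β ^ p ≤ p * α ^ (p - 1) * (α - β) := by
  rcases (hβ.trans hαβ).eq_or_lt with h0 | h0
  · have : β = 0 := by linarith
    simp [this, ← h0]
  · have h1 := one_add_mul_self_le_rpow_one_add (s := β / α - 1) (by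
      have : 0 ≤ β / α := by positivity
      linarith) hp.le
    rw [add_sub_cancel, Real.div_rpow hβ h0.le, le_div_iff₀ (by positivity)] at h1
    have h2 : α ^ p = α ^ (p - 1) * α := by
      rw [← Real.rpow_add_one h0.ne', sub_add_cancel]
    have h3 : (1 + p * (β / α - 1)) * α ^ p = α ^ p + p * α ^ (p - 1) * (β - α) := by
      rw [add_mul, one_mul, h2]
      field_simp
    linarith

/-- Only a positive left side matters, and positivity forces β < α t^{-(p-1)/p}. Hence with θ = 1 -
1/t the gap α - β is at least a fixed multiple of θα. The left side equals θ^{p-1}(α^p -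
t^{p-1}β^p), at most p (θα)^{p-1}(α - β) by convexity, and θα can be replaced by a multiple of α -
β. -/
theorem exists_cutoff_le {p : ℝ} (hp : 1 < p) :
    ∃ C : ℝ, 0 < C ∧ ∀ t α β : ℝ, 1 ≤ t → 0 ≤ α → 0 ≤ β →
      (t - 1) ^ (p - 1) * (α ^ p * t ^ (1 - p) - β ^ p) ≤ C * |α - β| ^ p := by
  have hp0 : 0 < p := by linarith
  have hp1 : 0 < p - 1 := by linarith
  refine ⟨p * (p / (p - 1)) ^ (p - 1), by positivity, fun t α β ht hα hβ => ?_⟩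
  have ht0 : 0 < t := by linarith
  have hnn : 0 ≤ p * (p / (p - 1)) ^ (p - 1) * |α - β| ^ p := by positivity
  have hfac : 0 ≤ (t - 1) ^ (p - 1) := Real.rpow_nonneg (by linarith) _
  by_cases hneg : α ^ p * t ^ (1 - p) - β ^ p ≤ 0
  · exact (mul_nonpos_of_nonneg_of_nonpos hfac hneg).trans hnn
  rw [not_le, sub_pos] at hneg
  set θ := 1 - t⁻¹ with hθ
  have htinv : t⁻¹ ≤ 1 := inv_le_one_of_one_le₀ ht
  have htinv0 : 0 < t⁻¹ := by positivity
  have hθ0 : 0 ≤ θ := by linarith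
  have hα0 : 0 < α := by
    refine lt_of_le_of_ne hα fun h => ?_
    rw [← h, Real.zero_rpow hp0.ne', zero_mul] at hneg
    exact absurd hneg (not_lt.2 (by positivity))
  set q := (p - 1) / p with hq
  -- Positivity gives β ≤ α (1 - θ)^q; as q ≤ 1, Bernoulli for concave powers gives (1 - θ)^q ≤ 1 -
  -- qθ.
  have hb : β ≤ α * (1 - q * θ) := by
    have h1 : β ≤ α * t⁻¹ ^ q := by
      rw [← Real.rpow_le_rpow_iff hβ (by positivity) hp0, Real.mul_rpow hα (by positivity),
        ← Real.rpow_mul htinv0.le, hq, div_mul_cancel₀ _ hp0.ne', Real.inv_rpow ht0.le,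
        ← Real.rpow_neg ht0.le, neg_sub]
      exact hneg.le
    have h2 := rpow_one_add_le_one_add_mul_self (s := -θ) (p := q) (by linarith)
      (by positivity) (by rw [hq, div_le_one hp0]; linarith)
    have h3 : 1 + -θ = t⁻¹ := by rw [hθ]; ring
    rw [h3] at h2
    refine h1.trans (mul_le_mul_of_nonneg_left (by linarith) hα)
  have hdiff : θ * α ≤ p / (p - 1) * (α - β) := by
    have : q * (θ * α) ≤ α - β := by nlinarith
    have h4 : p / (p - 1) * (q * (θ * α)) = θ * α := by
      rw [hq]; field_simp
    rw [← h4]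
    gcongr
  have hqp : 0 < q := by positivity
  have hαβ : 0 ≤ α - β := by
    have : 0 ≤ q * (θ * α) := by positivity
    nlinarith
  have e1 : (t - 1) ^ (p - 1) = θ ^ (p - 1) * t ^ (p - 1) := by
    rw [← Real.mul_rpow hθ0 ht0.le, hθ, sub_mul, inv_mul_cancel₀ ht0.ne', one_mul]
  have e2 : t ^ (p - 1) * t ^ (1 - p) = 1 := by
    rw [← Real.rpow_add ht0]; simp
  have e3 : 1 ≤ t ^ (p - 1) := Real.one_le_rpow ht hp1.le
  have hβp : 0 ≤ β ^ p := by positivity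
  calc (t - 1) ^ (p - 1) * (α ^ p * t ^ (1 - p) - β ^ p)
      = θ ^ (p - 1) * (α ^ p * (t ^ (p - 1) * t ^ (1 - p)) - t ^ (p - 1) * β ^ p) := by
        rw [e1]; ring
    _ ≤ θ ^ (p - 1) * (α ^ p - β ^ p) := by
        rw [e2, mul_one]
        gcongr
        exact le_mul_of_one_le_left hβp e3
    _ ≤ θ ^ (p - 1) * (p * α ^ (p - 1) * (α - β)) := by
        gcongr
        exact rpow_sub_rpow_le hp hβ (by linarith)
    _ = p * (θ * α) ^ (p - 1) * (α - β) := by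
        rw [Real.mul_rpow hθ0 hα]; ring
    _ ≤ p * (p / (p - 1) * (α - β)) ^ (p - 1) * (α - β) := by gcongr
    _ = p * (p / (p - 1)) ^ (p - 1) * |α - β| ^ p := by
        rw [Real.mul_rpow (by positivity) hαβ, abs_of_nonneg hαβ]
        have : (α - β) ^ p = (α - β) ^ (p - 1) * (α - β) := by
          rcases hαβ.eq_or_lt with h0 | h0
          · rw [← h0, mul_zero, Real.zero_rpow hp0.ne']
          · rw [← Real.rpow_add_one h0.ne', sub_add_cancel]
        rw [this]; ring

/-- The degrees p - 1 and 1 - p in (A, B) cancel, so only the ratio A/B matters. -/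
theorem test_product_eq {p A B : ℝ} (hp : 1 < p) (hB : 0 < B) (hAB : B ≤ A) (a b : ℝ) :
    |A - B| ^ (p - 2) * (A - B) * (a * A ^ (1 - p) - b * B ^ (1 - p)) =
      (A / B - 1) ^ (p - 1) * (a * (A / B) ^ (1 - p) - b) := by
  have hA : 0 < A := hB.trans_le hAB
  rw [abs_rpow_sub_two_mul_self hp (by linarith)]
  have e1 : A / B - 1 = (A - B) / B := by field_simp
  have e2 : B ^ (1 - p) = (B ^ (p - 1))⁻¹ := by rw [← Real.rpow_neg hB.le]; ring_nf
  rw [e1, Real.div_rpow (by linarith) hB.le, Real.div_rpow hA.le hB.le, e2]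
  have : B ^ (p - 1) ≠ 0 := by positivity
  field_simp

/-- The algebraic inequality behind the logarithmic estimate. -/
theorem exists_log_test_le {p : ℝ} (hp : 1 < p) :
    ∃ c C : ℝ, 0 < c ∧ 0 < C ∧ ∀ A B α β : ℝ, 0 < A → 0 < B → 0 ≤ α → 0 ≤ β →
      (|A - B| ^ (p - 2) * (A - B) * (α ^ p * A ^ (1 - p) - β ^ p * B ^ (1 - p)) ≤
        C * |α - β| ^ p) ∧
      c * |Real.log (A / B)| ^ p + |A - B| ^ (p - 2) * (A - B) * (A ^ (1 - p) - B ^ (1 - p)) ≤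
        0 := by
  obtain ⟨c, hc, H⟩ := exists_log_rpow_le hp
  obtain ⟨C, hC, H'⟩ := exists_cutoff_le hp
  have main : ∀ A B α β : ℝ, 0 < B → B ≤ A → 0 ≤ α → 0 ≤ β →
      (|A - B| ^ (p - 2) * (A - B) * (α ^ p * A ^ (1 - p) - β ^ p * B ^ (1 - p)) ≤
        C * |α - β| ^ p) ∧
      c * |Real.log (A / B)| ^ p + |A - B| ^ (p - 2) * (A - B) * (A ^ (1 - p) - B ^ (1 - p)) ≤
        0 := by
    intro A B α β hB hAB hα hβ
    have ht : 1 ≤ A / B := (one_le_div hB).2 hAB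
    constructor
    · rw [test_product_eq hp hB hAB]
      exact H' _ _ _ ht hα hβ
    · have h1 := test_product_eq hp hB hAB 1 1
      rw [one_mul, one_mul, one_mul] at h1
      rw [h1, abs_of_nonneg (Real.log_nonneg ht)]
      have := H _ ht
      linarith
  refine ⟨c, C, hc, hC, fun A B α β hA hB hα hβ => ?_⟩
  rcases le_total B A with hAB | hAB
  · exact main A B α β hB hAB hα hβ
  · have h1 := main B A β α hA hAB hβ hα
    have e1 : |Real.log (B / A)| = |Real.log (A / B)| := by
      rw [← inv_div, Real.log_inv, abs_neg]
    rw [e1, abs_sub_comm B A, abs_sub_comm β α] at h1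
    constructor
    · convert h1.1 using 1; ring
    · convert h1.2 using 1; ring

/-- The interaction of a point of the support of the cutoff with a point outside it. -/
theorem test_outside_le {p a b d : ℝ} (hp : 1 < p) (ha : 0 ≤ a) (hd : 0 < d) :
    |a - b| ^ (p - 2) * (a - b) * (a + d) ^ (1 - p) ≤
      2 ^ (p - 1) * (1 + d ^ (1 - p) * max (-b) 0 ^ (p - 1)) := by
  have hpos : 0 ≤ 2 ^ (p - 1) * (1 + d ^ (1 - p) * max (-b) 0 ^ (p - 1)) := by positivity
  have had : 0 < a + d := by linarith
  rcases le_total a b with hab | hab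
  · refine le_trans ?_ hpos
    refine mul_nonpos_of_nonpos_of_nonneg ?_ (by positivity)
    exact mul_nonpos_of_nonneg_of_nonpos (by positivity) (by linarith)
  · rw [abs_rpow_sub_two_mul_self hp (by linarith)]
    set v := max (-b) 0 with hv
    have hv0 : 0 ≤ v := le_max_right _ _
    have hp1 : 0 < p - 1 := by linarith
    have h1 : (a - b) ^ (p - 1) ≤ 2 ^ (p - 1) * (a ^ (p - 1) + v ^ (p - 1)) := by
      have h2 : a - b ≤ 2 * max a v := by
        have := le_max_left (-b) 0
        have := le_max_left a v
        have := le_max_right a v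
        linarith
      calc (a - b) ^ (p - 1) ≤ (2 * max a v) ^ (p - 1) :=
            Real.rpow_le_rpow (by linarith) h2 hp1.le
        _ = 2 ^ (p - 1) * max a v ^ (p - 1) := Real.mul_rpow (by norm_num) (by positivity)
        _ ≤ _ := by
            gcongr
            rcases max_cases a v with ⟨h, _⟩ | ⟨h, _⟩ <;> rw [h]
            · exact le_add_of_nonneg_right (by positivity)
            · exact le_add_of_nonneg_left (by positivity)
    have h3 : a ^ (p - 1) * (a + d) ^ (1 - p) ≤ 1 := by
      have : (a + d) ^ (1 - p) = ((a + d) ^ (p - 1))⁻¹ := by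
        rw [← Real.rpow_neg had.le]; ring_nf
      rw [this, ← div_eq_mul_inv, div_le_one (by positivity)]
      gcongr
      linarith
    have h4 : (a + d) ^ (1 - p) ≤ d ^ (1 - p) :=
      Real.rpow_le_rpow_of_nonpos hd (by linarith) (by linarith)
    calc (a - b) ^ (p - 1) * (a + d) ^ (1 - p)
        ≤ 2 ^ (p - 1) * (a ^ (p - 1) + v ^ (p - 1)) * (a + d) ^ (1 - p) := by gcongr
      _ = 2 ^ (p - 1) * (a ^ (p - 1) * (a + d) ^ (1 - p) + (a + d) ^ (1 - p) * v ^ (p - 1)) := by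
          ring
      _ ≤ _ := by gcongr

/-! ### The cutoff function and its energy -/

/-- The cutoff function equal to `1` on `B(x₀, r)` and to `0` outside `B(x₀, 3r/2)`. -/
noncomputable def ccCutoff {n : ℕ} (h m : ℕ) (x₀ : GSpace n) (r : ℝ) (x : GSpace n) : ℝ :=
  min 1 (max 0 (3 - 2 * dC h m x x₀ / r))

section Cutoff

variable {n h m : ℕ} {x₀ : GSpace n} {r : ℝ}

theorem ccCutoff_nonneg (x : GSpace n) : 0 ≤ ccCutoff h m x₀ r x :=
  le_min zero_le_one (le_max_left _ _)

theorem ccCutoff_le_one (x : GSpace n) : ccCutoff h m x₀ r x ≤ 1 := min_le_left _ _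

theorem ccCutoff_eq_one (hr : 0 < r) {x : GSpace n} (hx : dC h m x x₀ ≤ r) :
    ccCutoff h m x₀ r x = 1 := by
  have h1 : 2 * dC h m x x₀ / r ≤ 2 := by rw [div_le_iff₀ hr]; linarith
  exact min_eq_left (le_max_of_le_right (by linarith))

theorem ccCutoff_eq_zero (hr : 0 < r) {x : GSpace n} (hx : 3 / 2 * r ≤ dC h m x x₀) :
    ccCutoff h m x₀ r x = 0 := by
  have h1 : 3 ≤ 2 * dC h m x x₀ / r := by rw [le_div_iff₀ hr]; linarith
  rw [ccCutoff, max_eq_left (by linarith)]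
  exact min_eq_right zero_le_one

/-- Clamping is 1-Lipschitz and d_C(·, x₀) is 1-Lipschitz for d_C. The bound is the truncation used
in the kernel integral. -/
theorem abs_ccCutoff_sub_le (hh : 1 ≤ h) (hhn : h ≤ n) (hr : 0 < r) (x y : GSpace n) :
    |ccCutoff h m x₀ r x - ccCutoff h m x₀ r y| ≤ min 1 (2 * dC h m x y / r) := by
  refine le_min ?_ ?_
  · have h1 := ccCutoff_nonneg (h := h) (m := m) (x₀ := x₀) (r := r) x
    have h2 := ccCutoff_nonneg (h := h) (m := m) (x₀ := x₀) (r := r) y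
    have h3 := ccCutoff_le_one (h := h) (m := m) (x₀ := x₀) (r := r) x
    have h4 := ccCutoff_le_one (h := h) (m := m) (x₀ := x₀) (r := r) y
    exact abs_le.2 ⟨by linarith, by linarith⟩
  · refine (abs_min_sub_min_le_max _ _ _ _).trans ?_
    rw [sub_self, abs_zero, max_eq_right (abs_nonneg _)]
    refine (abs_max_sub_max_le_max _ _ _ _).trans ?_
    rw [sub_self, abs_zero, max_eq_right (abs_nonneg _), sub_sub_sub_cancel_left, ← sub_div,
      abs_div, abs_of_pos hr, ← mul_sub, abs_mul, abs_two]
    have t1 := dC_triangle hh hhn m x y x₀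
    have t2 := dC_triangle hh hhn m y x x₀
    have t3 := dC_comm h m y x
    have : |dC h m y x₀ - dC h m x x₀| ≤ dC h m x y := abs_le.2 ⟨by linarith, by linarith⟩
    gcongr

theorem continuous_dC_left (hh : 1 ≤ h) (hhn : h ≤ n) (m : ℕ) (x₀ : GSpace n) :
    Continuous fun x : GSpace n => dC h m x x₀ :=
  (continuous_dC hh hhn m).comp (continuous_id.prodMk continuous_const)

theorem measurable_ccCutoff (hh : 1 ≤ h) (hhn : h ≤ n) :
    Measurable (ccCutoff h m x₀ r) := by
  have h1 := continuous_dC_left hh hhn m x₀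
  have h2 : Continuous fun x : GSpace n => min 1 (max 0 (3 - 2 * dC h m x x₀ / r)) := by
    fun_prop
  exact h2.measurable

theorem volume_ccBall_two_mul_le (hh : 1 ≤ h) (hhn : h ≤ n) (m : ℕ) (x₀ : GSpace n) (hr : 0 < r) :
    volume (ccBall h m x₀ (2 * r)) ≤ ENNReal.ofReal
      (4 ^ n * n ^ (m * (n - h)) * r ^ n * (hNorm h x₀ + 2 * r) ^ (m * (n - h))) := by
  refine (volume_ccBall_le hh hhn m x₀ (by positivity)).trans (ENNReal.ofReal_le_ofReal ?_)
  have hN := hNorm_nonneg h x₀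
  have hn1 : (1 : ℝ) ≤ n := by exact_mod_cast hh.trans hhn
  have h1 : hNorm h x₀ + n * (2 * r) ≤ n * (hNorm h x₀ + 2 * r) := by
    have := le_mul_of_one_le_left hN hn1
    linarith
  have h0 : 0 ≤ hNorm h x₀ + n * (2 * r) := by positivity
  calc _ ≤ 2 ^ n * (2 * r) ^ n * (n * (hNorm h x₀ + 2 * r)) ^ (m * (n - h)) := by gcongr
    _ = _ := by
      rw [mul_pow, mul_pow, show (4 : ℝ) = 2 * 2 by norm_num, mul_pow]
      ring

/-- The Gagliardo energy of the cutoff function. -/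
theorem exists_gagliardo_ccCutoff_le (hh : 1 ≤ h) (hhn : h ≤ n) {s p : ℝ}
    (hp : 0 < p) (hsp : 0 < s * p) (hspm : s * p + (m * (n - h) : ℕ) < p) :
    ∃ C : ℝ, 0 < C ∧ ∀ (x₀ : GSpace n) (r : ℝ), 0 < r →
      gagliardo h m s p (ccCutoff h m x₀ r) ≤
        ENNReal.ofReal (C * r ^ (2 * (n : ℝ) - homDim n h m - s * p) *
          (hNorm h x₀ + 2 * r) ^ (m * (n - h)) * (hNorm h x₀ + 2 * r) ^ (m * (n - h))) := by
  obtain ⟨C, hC, H⟩ := exists_lintegral_gKernel_mul_min_le hh hhn hp.le hsp hspm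
  have hn1 : (1 : ℝ) ≤ n := by exact_mod_cast hh.trans hhn
  refine ⟨2 * (C * (2 * n + 1) ^ (m * (n - h)) * (4 ^ n * n ^ (m * (n - h)))),
    by positivity, fun x₀ r hr => ?_⟩
  have hN := hNorm_nonneg h x₀
  set N := hNorm h x₀ + 2 * r with hNdef
  have hN0 : 0 ≤ N := by positivity
  set w : GSpace n × GSpace n → ℝ≥0∞ := fun z =>
    ENNReal.ofReal (gKernel h m s p z.1 z.2 * min 1 (2 * dC h m z.1 z.2 / r) ^ p) with hw
  have hwm : Measurable w := by
    refine ENNReal.measurable_ofReal.comp ((measurable_gKernel hh hhn m s p).mul ?_)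
    exact (measurable_const.min (((measurable_dC hh hhn m).const_mul 2).div_const r)).pow_const p
  set B := ccBall h m x₀ (2 * r) with hB
  have hBm : MeasurableSet B := (isOpen_ccBall hh hhn m x₀ _).measurableSet
  -- The energy density vanishes unless one of the two points lies in B(x₀, 2r); by symmetry `g` and
  -- its swap cover both possibilities.
  set g : GSpace n × GSpace n → ℝ≥0∞ := (B ×ˢ univ).indicator w with hg
  have hgm : Measurable g := hwm.indicator (hBm.prod MeasurableSet.univ)
  have hpt : ∀ z : GSpace n × GSpace n, ENNReal.ofReal (gKernel h m s p z.1 z.2 *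
      |ccCutoff h m x₀ r z.1 - ccCutoff h m x₀ r z.2| ^ p) ≤ g z + g z.swap := by
    rintro ⟨x, y⟩
    have hle : ENNReal.ofReal (gKernel h m s p x y *
        |ccCutoff h m x₀ r x - ccCutoff h m x₀ r y| ^ p) ≤ w (x, y) := by
      refine ENNReal.ofReal_le_ofReal (mul_le_mul_of_nonneg_left ?_ (gKernel_nonneg _ _ _ _ _ _))
      exact Real.rpow_le_rpow (abs_nonneg _) (abs_ccCutoff_sub_le hh hhn hr x y) hp.le
    by_cases hx : x ∈ B
    · refine hle.trans (le_trans (le_of_eq ?_) le_self_add)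
      rw [hg, indicator_of_mem (show (x, y) ∈ B ×ˢ univ from ⟨hx, mem_univ _⟩)]
    by_cases hy : y ∈ B
    · refine hle.trans (le_trans (le_of_eq ?_) le_add_self)
      rw [hg, Prod.swap_prod_mk,
        indicator_of_mem (show (y, x) ∈ B ×ˢ univ from ⟨hy, mem_univ _⟩), hw]
      simp only [gKernel_comm h m s p x y, dC_comm h m x y]
    · have hx' : 2 * r ≤ dC h m x x₀ := not_lt.1 hx
      have hy' : 2 * r ≤ dC h m y x₀ := not_lt.1 hy
      simp only [ccCutoff_eq_zero hr (show 3 / 2 * r ≤ dC h m x x₀ by linarith),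
        ccCutoff_eq_zero hr (show 3 / 2 * r ≤ dC h m y x₀ by linarith)]
      simp [Real.zero_rpow hp.ne']
  have hgint : ∫⁻ z, g z ≤ ENNReal.ofReal (C * r ^ ((n : ℝ) - homDim n h m - s * p) *
      ((2 * n + 1) * N) ^ (m * (n - h))) * volume B := by
    rw [hg, lintegral_indicator (hBm.prod MeasurableSet.univ), Measure.volume_eq_prod,
      ← Measure.prod_restrict, Measure.restrict_univ, lintegral_prod _ hwm.aemeasurable,
      ← setLIntegral_const]
    refine setLIntegral_mono measurable_const fun x hx => (H x r hr).trans ?_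
    refine ENNReal.ofReal_le_ofReal ?_
    have h1 : hNorm h x ≤ hNorm h x₀ + n * (2 * r) :=
      hNorm_le_of_dC_lt hh hhn (by rw [dC_comm]; exact hx)
    have h2 : hNorm h x + r ≤ (2 * n + 1) * N := by
      have : 0 ≤ n * hNorm h x₀ := by positivity
      have : 0 ≤ n * r := by positivity
      rw [hNdef]
      linarith
    have h3 := hNorm_nonneg h x
    gcongr
  calc gagliardo h m s p (ccCutoff h m x₀ r) ≤ ∫⁻ z, (g z + g z.swap) := lintegral_mono hpt
    _ = 2 * ∫⁻ z, g z := by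
        rw [lintegral_add_left hgm, two_mul]
        congr 1
        exact lintegral_prod_swap g
    _ ≤ 2 * (ENNReal.ofReal (C * r ^ ((n : ℝ) - homDim n h m - s * p) *
          ((2 * n + 1) * N) ^ (m * (n - h))) *
          ENNReal.ofReal (4 ^ n * n ^ (m * (n - h)) * r ^ n * N ^ (m * (n - h)))) := by
        gcongr
        exact hgint.trans (mul_le_mul_right (volume_ccBall_two_mul_le hh hhn m x₀ hr) _)
    _ = _ := by
        rw [← ENNReal.ofReal_ofNat 2, ← ENNReal.ofReal_mul (by positivity),
          ← ENNReal.ofReal_mul (by positivity)]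
        congr 1
        have e1 : r ^ (2 * (n : ℝ) - homDim n h m - s * p) =
            r ^ ((n : ℝ) - homDim n h m - s * p) * r ^ n := by
          rw [← Real.rpow_natCast r n, ← Real.rpow_add hr]
          ring_nf
        rw [e1, mul_pow]
        ring

end Cutoff

/-! ### Admissibility of the test function -/

/-- The test function `φ^p (u₊ + d)^{1-p}` of the logarithmic estimate. -/
noncomputable def logTest {n : ℕ} (h m : ℕ) (p : ℝ) (x₀ : GSpace n) (r d : ℝ) (u : GSpace n → ℝ)
    (x : GSpace n) : ℝ :=
  ccCutoff h m x₀ r x ^ p * (max (u x) 0 + d) ^ (1 - p)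

theorem abs_rpow_sub_rpow_le {p α β : ℝ} (hp : 1 < p) (hα : 0 ≤ α) (hβ : 0 ≤ β) (hα1 : α ≤ 1)
    (hβ1 : β ≤ 1) : |α ^ p - β ^ p| ≤ p * |α - β| := by
  have main : ∀ α β : ℝ, 0 ≤ β → β ≤ α → α ≤ 1 → |α ^ p - β ^ p| ≤ p * |α - β| := by
    intro α β hβ hαβ hα1
    have h0 : β ^ p ≤ α ^ p := Real.rpow_le_rpow hβ hαβ (by linarith)
    rw [abs_of_nonneg (by linarith), abs_of_nonneg (by linarith)]
    refine (rpow_sub_rpow_le hp hβ hαβ).trans ?_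
    have h1 : α ^ (p - 1) ≤ 1 := Real.rpow_le_one (hβ.trans hαβ) hα1 (by linarith)
    have h2 : 0 ≤ α - β := by linarith
    have h3 : 0 ≤ p := by linarith
    calc p * α ^ (p - 1) * (α - β) ≤ p * 1 * (α - β) := by gcongr
      _ = _ := by ring
  rcases le_total β α with hle | hle
  · exact main α β hβ hle hα1
  · rw [abs_sub_comm, abs_sub_comm α]
    exact main β α hα hle hβ1

theorem abs_rpow_one_sub_sub_le {p d A B : ℝ} (hp : 1 < p) (hd : 0 < d) (hA : d ≤ A)
    (hB : d ≤ B) : |A ^ (1 - p) - B ^ (1 - p)| ≤ p * d ^ (-p) * |A - B| := by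
  have main : ∀ A B : ℝ, d ≤ B → B ≤ A →
      |A ^ (1 - p) - B ^ (1 - p)| ≤ p * d ^ (-p) * |A - B| := by
    intro A B hB hAB
    have hB0 : 0 < B := hd.trans_le hB
    have hA0 : 0 < A := hB0.trans_le hAB
    have h0 : A ^ (1 - p) ≤ B ^ (1 - p) := Real.rpow_le_rpow_of_nonpos hB0 hAB (by linarith)
    rw [abs_sub_comm, abs_of_nonneg (by linarith), abs_of_nonneg (by linarith)]
    set v := B / A with hv
    have hv0 : 0 < v := by positivity
    have hv1 : v ≤ 1 := (div_le_one hA0).2 hAB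
    -- The exponent p - 1 may be less than 1, so the convexity bound is applied to v^p instead: 1 -
    -- v^{p-1} ≤ 1 - v^p ≤ p(1 - v).
    have h1 : v ^ p ≤ v ^ (p - 1) := Real.rpow_le_rpow_of_exponent_ge hv0 hv1 (by linarith)
    have h2 := rpow_sub_rpow_le hp hv0.le hv1
    rw [Real.one_rpow, Real.one_rpow, mul_one] at h2
    have h3 : A ^ (1 - p) = B ^ (1 - p) * v ^ (p - 1) := by
      have : A = B * v⁻¹ := by rw [hv]; field_simp
      rw [this, Real.mul_rpow hB0.le (by positivity), Real.inv_rpow hv0.le,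
        ← Real.rpow_neg hv0.le, neg_sub]
    have h4 : 1 - v ≤ (A - B) / d := by
      have : 1 - v = (A - B) / A := by rw [hv]; field_simp
      rw [this]
      have : 0 ≤ A - B := by linarith
      gcongr
      linarith
    have h5 : B ^ (1 - p) ≤ d ^ (1 - p) := Real.rpow_le_rpow_of_nonpos hd hB (by linarith)
    have h6 : d ^ (1 - p) = d * d ^ (-p) := by
      rw [sub_eq_add_neg, Real.rpow_add hd, Real.rpow_one]
    have h7 : 0 ≤ (A - B) / d := div_nonneg (by linarith) hd.le
    have h8 : 0 ≤ p := by linarith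
    calc B ^ (1 - p) - A ^ (1 - p) = B ^ (1 - p) * (1 - v ^ (p - 1)) := by rw [h3]; ring
      _ ≤ B ^ (1 - p) * (p * ((A - B) / d)) := by
          gcongr
          calc 1 - v ^ (p - 1) ≤ p * (1 - v) := by linarith
            _ ≤ _ := by gcongr
      _ ≤ d ^ (1 - p) * (p * ((A - B) / d)) := by gcongr
      _ = _ := by rw [h6]; field_simp
  rcases le_total B A with hle | hle
  · exact main A B hB hle
  · rw [abs_sub_comm, abs_sub_comm A]
    exact main B A hA hle

section LogTest

variable {n h m : ℕ} {x₀ : GSpace n} {r d p s : ℝ} {u : GSpace n → ℝ}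

theorem logTest_nonneg (hd : 0 < d) (x : GSpace n) : 0 ≤ logTest h m p x₀ r d u x := by
  have := ccCutoff_nonneg (h := h) (m := m) (x₀ := x₀) (r := r) x
  unfold logTest
  positivity

/-- The test function is a Lipschitz function of the pair (φ, u), because 0 ≤ φ ≤ 1 and u₊ + d ≥ d.
It therefore inherits finite Gagliardo energy from φ and u; the dependence on d is harmless, as this
serves admissibility only. -/
theorem abs_logTest_sub_le (hp : 1 < p) (hd : 0 < d) (x y : GSpace n) :
    |logTest h m p x₀ r d u x - logTest h m p x₀ r d u y| ≤
      d ^ (1 - p) * p * |ccCutoff h m x₀ r x - ccCutoff h m x₀ r y| +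
        p * d ^ (-p) * |u x - u y| := by
  have a0 := ccCutoff_nonneg (h := h) (m := m) (x₀ := x₀) (r := r) x
  have a1 := ccCutoff_le_one (h := h) (m := m) (x₀ := x₀) (r := r) x
  have b0 := ccCutoff_nonneg (h := h) (m := m) (x₀ := x₀) (r := r) y
  have b1 := ccCutoff_le_one (h := h) (m := m) (x₀ := x₀) (r := r) y
  unfold logTest
  set α := ccCutoff h m x₀ r x
  set β := ccCutoff h m x₀ r y
  set A := max (u x) 0 + d with hA
  set B := max (u y) 0 + d with hB
  have hAd : d ≤ A := le_add_of_nonneg_left (le_max_right _ _)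
  have hBd : d ≤ B := le_add_of_nonneg_left (le_max_right _ _)
  have h1 := abs_rpow_sub_rpow_le hp a0 b0 a1 b1
  have h2 := abs_rpow_one_sub_sub_le hp hd hAd hBd
  have h3 : |A - B| ≤ |u x - u y| := by
    rw [hA, hB, add_sub_add_right_eq_sub]
    refine (abs_max_sub_max_le_max _ _ _ _).trans ?_
    simp
  have h4 : A ^ (1 - p) ≤ d ^ (1 - p) := Real.rpow_le_rpow_of_nonpos hd hAd (by linarith)
  have h5 : β ^ p ≤ 1 := Real.rpow_le_one b0 b1 (by linarith)
  have h6 : 0 ≤ A ^ (1 - p) := Real.rpow_nonneg (hd.le.trans hAd) _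
  have h7 : 0 ≤ β ^ p := Real.rpow_nonneg b0 _
  calc |α ^ p * A ^ (1 - p) - β ^ p * B ^ (1 - p)|
      = |A ^ (1 - p) * (α ^ p - β ^ p) + β ^ p * (A ^ (1 - p) - B ^ (1 - p))| := by
        congr 1; ring
    _ ≤ |A ^ (1 - p) * (α ^ p - β ^ p)| + |β ^ p * (A ^ (1 - p) - B ^ (1 - p))| := abs_add_le _ _
    _ = A ^ (1 - p) * |α ^ p - β ^ p| + β ^ p * |A ^ (1 - p) - B ^ (1 - p)| := by
        rw [abs_mul, abs_mul, abs_of_nonneg h6, abs_of_nonneg h7]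
    _ ≤ d ^ (1 - p) * (p * |α - β|) + 1 * (p * d ^ (-p) * |u x - u y|) := by
        gcongr
        refine h2.trans ?_
        gcongr
    _ = _ := by ring

theorem aemeasurable_logTest (hh : 1 ≤ h) (hhn : h ≤ n) (hu : AEMeasurable u) :
    AEMeasurable (logTest h m p x₀ r d u) := by
  unfold logTest
  exact ((measurable_ccCutoff hh hhn).pow_const p).aemeasurable.mul
    (((hu.max aemeasurable_const).add_const d).pow_const _)

theorem logTest_eq_zero (hp : 0 < p) (hr : 0 < r) {x : GSpace n} (hx : 3 / 2 * r ≤ dC h m x x₀) :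
    logTest h m p x₀ r d u x = 0 := by
  rw [logTest, ccCutoff_eq_zero hr hx, Real.zero_rpow hp.ne', zero_mul]

theorem memLp_logTest (hh : 1 ≤ h) (hhn : h ≤ n) (hp : 1 < p) (hr : 0 < r) (hd : 0 < d)
    (hu : AEMeasurable u) : MemLp (logTest h m p x₀ r d u) (ENNReal.ofReal p) volume := by
  have hBm := (isOpen_ccBall hh hhn m x₀ (2 * r)).measurableSet
  have hfin : volume (ccBall h m x₀ (2 * r)) ≠ ⊤ :=
    ((volume_ccBall_two_mul_le hh hhn m x₀ hr).trans_lt ENNReal.ofReal_lt_top).ne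
  refine (memLp_indicator_const (ENNReal.ofReal p) hBm (d ^ (1 - p)) (Or.inr hfin)).mono
    (aemeasurable_logTest hh hhn hu).aestronglyMeasurable (Filter.Eventually.of_forall fun x => ?_)
  by_cases hx : x ∈ ccBall h m x₀ (2 * r)
  · rw [indicator_of_mem hx, Real.norm_of_nonneg (logTest_nonneg hd x),
      Real.norm_of_nonneg (by positivity)]
    have h1 : ccCutoff h m x₀ r x ^ p ≤ 1 :=
      Real.rpow_le_one (ccCutoff_nonneg x) (ccCutoff_le_one x) (by linarith)
    have h2 : (max (u x) 0 + d) ^ (1 - p) ≤ d ^ (1 - p) :=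
      Real.rpow_le_rpow_of_nonpos hd (le_add_of_nonneg_left (le_max_right _ _)) (by linarith)
    calc _ ≤ 1 * d ^ (1 - p) := by
          unfold logTest
          gcongr
      _ = _ := one_mul _
  · have hx' : 2 * r ≤ dC h m x x₀ := not_lt.1 hx
    rw [logTest_eq_zero (by linarith) hr (by linarith)]
    simp

theorem add_rpow_le_two_mul {a b p : ℝ} (ha : 0 ≤ a) (hb : 0 ≤ b) (hp : 0 ≤ p) :
    (a + b) ^ p ≤ 2 ^ p * (a ^ p + b ^ p) := by
  calc (a + b) ^ p ≤ (2 * max a b) ^ p := by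
        gcongr
        linarith [le_max_left a b, le_max_right a b]
    _ = 2 ^ p * max a b ^ p := Real.mul_rpow (by norm_num) (by positivity)
    _ ≤ _ := by
        gcongr
        rcases max_cases a b with ⟨h, _⟩ | ⟨h, _⟩ <;> rw [h]
        · exact le_add_of_nonneg_right (by positivity)
        · exact le_add_of_nonneg_left (by positivity)

theorem aemeasurable_gagliardo_integrand (hh : 1 ≤ h) (hhn : h ≤ n) (hu : AEMeasurable u) :
    AEMeasurable fun z : GSpace n × GSpace n =>
      gKernel h m s p z.1 z.2 * |u z.1 - u z.2| ^ p := by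
  have h1 : AEMeasurable fun z : GSpace n × GSpace n => u z.1 :=
    hu.comp_quasiMeasurePreserving Measure.quasiMeasurePreserving_fst
  have h2 : AEMeasurable fun z : GSpace n × GSpace n => u z.2 :=
    hu.comp_quasiMeasurePreserving Measure.quasiMeasurePreserving_snd
  have h3 : AEMeasurable fun z : GSpace n × GSpace n => |u z.1 - u z.2| := by
    have h4 : AEMeasurable fun z : GSpace n × GSpace n => u z.1 - u z.2 := h1.sub h2
    simpa only [Real.norm_eq_abs] using h4.norm
  exact (measurable_gKernel hh hhn m s p).aemeasurable.mul (h3.pow_const p)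

theorem gagliardo_logTest_lt_top (hh : 1 ≤ h) (hhn : h ≤ n) (hp : 1 < p) (hsp : 0 < s * p)
    (hspm : s * p + (m * (n - h) : ℕ) < p) (hr : 0 < r) (hd : 0 < d)
    (hug : gagliardo h m s p u < ⊤) : gagliardo h m s p (logTest h m p x₀ r d u) < ⊤ := by
  obtain ⟨C, -, H⟩ := exists_gagliardo_ccCutoff_le hh hhn (by linarith : 0 < p) hsp hspm
  have hφ : gagliardo h m s p (ccCutoff h m x₀ r) < ⊤ := (H x₀ r hr).trans_lt ENNReal.ofReal_lt_top
  set c₁ := 2 ^ p * (d ^ (1 - p) * p) ^ p with hc₁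
  set c₂ := 2 ^ p * (p * d ^ (-p)) ^ p with hc₂
  have hp0 : 0 < p := by linarith
  have hc₁0 : 0 ≤ c₁ := by positivity
  have hc₂0 : 0 ≤ c₂ := by positivity
  have hle : gagliardo h m s p (logTest h m p x₀ r d u) ≤
      ENNReal.ofReal c₁ * gagliardo h m s p (ccCutoff h m x₀ r) +
        ENNReal.ofReal c₂ * gagliardo h m s p u := by
    unfold gagliardo
    rw [← lintegral_const_mul' _ _ ENNReal.ofReal_ne_top,
      ← lintegral_const_mul' _ _ ENNReal.ofReal_ne_top, ← lintegral_add_left']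
    · refine lintegral_mono fun z => ?_
      have hK := gKernel_nonneg h m s p z.1 z.2
      simp only
      rw [← ENNReal.ofReal_mul hc₁0, ← ENNReal.ofReal_mul hc₂0,
        ← ENNReal.ofReal_add (by positivity) (by positivity)]
      refine ENNReal.ofReal_le_ofReal ?_
      calc _ ≤ gKernel h m s p z.1 z.2 *
            (d ^ (1 - p) * p * |ccCutoff h m x₀ r z.1 - ccCutoff h m x₀ r z.2| +
              p * d ^ (-p) * |u z.1 - u z.2|) ^ p := by
            gcongr
            exact abs_logTest_sub_le hp hd z.1 z.2
        _ ≤ gKernel h m s p z.1 z.2 * (2 ^ p *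
            ((d ^ (1 - p) * p * |ccCutoff h m x₀ r z.1 - ccCutoff h m x₀ r z.2|) ^ p +
              (p * d ^ (-p) * |u z.1 - u z.2|) ^ p)) := by
            gcongr
            exact add_rpow_le_two_mul (by positivity) (by positivity) hp0.le
        _ = _ := by
            rw [Real.mul_rpow (by positivity) (abs_nonneg _),
              Real.mul_rpow (by positivity) (abs_nonneg _), hc₁, hc₂]
            ring
    · exact (aemeasurable_gagliardo_integrand hh hhn
        (measurable_ccCutoff hh hhn).aemeasurable).ennreal_ofReal.const_mul _
  exact hle.trans_lt (ENNReal.add_lt_top.2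
    ⟨ENNReal.mul_lt_top ENNReal.ofReal_lt_top hφ, ENNReal.mul_lt_top ENNReal.ofReal_lt_top hug⟩)

theorem memWsp0_logTest (hh : 1 ≤ h) (hhn : h ≤ n) (hp : 1 < p) (hsp : 0 < s * p)
    (hspm : s * p + (m * (n - h) : ℕ) < p) (hr : 0 < r) (hd : 0 < d) (hu : MemWsp h m s p u)
    {Ω : Set (GSpace n)} (hΩ : ccBall h m x₀ (2 * r) ⊆ Ω) :
    MemWsp0 h m s p Ω (logTest h m p x₀ r d u) := by
  have hum := hu.1.aestronglyMeasurable.aemeasurable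
  refine ⟨⟨memLp_logTest hh hhn hp hr hd hum,
    gagliardo_logTest_lt_top hh hhn hp hsp hspm hr hd hu.2⟩,
    Filter.Eventually.of_forall fun x hx => ?_⟩
  have hx' : 2 * r ≤ dC h m x x₀ := not_lt.1 fun hlt => hx (hΩ hlt)
  exact logTest_eq_zero (by linarith) hr (by linarith)

end LogTest

/-! ### The weak form and its pointwise bound -/

theorem integrable_gagliardo_integrand {n h m : ℕ} (hh : 1 ≤ h) (hhn : h ≤ n) {s p : ℝ}
    {u : GSpace n → ℝ} (hu : AEMeasurable u) (hug : gagliardo h m s p u < ⊤) :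
    Integrable fun z : GSpace n × GSpace n => gKernel h m s p z.1 z.2 * |u z.1 - u z.2| ^ p := by
  refine (lintegral_ofReal_ne_top_iff_integrable
    (aemeasurable_gagliardo_integrand hh hhn hu).aestronglyMeasurable
    (Filter.Eventually.of_forall fun z => ?_)).1 hug.ne
  exact mul_nonneg (gKernel_nonneg _ _ _ _ _ _) (by positivity)

/-- The weak form is an absolutely convergent integral on `W^{s,p}`. -/
theorem integrable_weakForm {n h m : ℕ} (hh : 1 ≤ h) (hhn : h ≤ n) {s p : ℝ} (hp : 1 < p)
    {u η : GSpace n → ℝ} (hu : MemWsp h m s p u) (hη : MemWsp h m s p η) :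
    Integrable fun z : GSpace n × GSpace n => gKernel h m s p z.1 z.2 *
      |u z.1 - u z.2| ^ (p - 2) * (u z.1 - u z.2) * (η z.1 - η z.2) := by
  have hum := hu.1.aestronglyMeasurable.aemeasurable
  have hηm := hη.1.aestronglyMeasurable.aemeasurable
  have du : AEMeasurable fun z : GSpace n × GSpace n => u z.1 - u z.2 :=
    (hum.comp_quasiMeasurePreserving Measure.quasiMeasurePreserving_fst).sub
      (hum.comp_quasiMeasurePreserving Measure.quasiMeasurePreserving_snd)
  have dη : AEMeasurable fun z : GSpace n × GSpace n => η z.1 - η z.2 :=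
    (hηm.comp_quasiMeasurePreserving Measure.quasiMeasurePreserving_fst).sub
      (hηm.comp_quasiMeasurePreserving Measure.quasiMeasurePreserving_snd)
  have du' : AEMeasurable fun z : GSpace n × GSpace n => |u z.1 - u z.2| := by
    simpa only [Real.norm_eq_abs] using du.norm
  refine ((integrable_gagliardo_integrand hh hhn hum hu.2).add
    (integrable_gagliardo_integrand hh hhn hηm hη.2)).mono' ?_
    (Filter.Eventually.of_forall fun z => ?_)
  · exact ((((measurable_gKernel hh hhn m s p).aemeasurable.mul (du'.pow_const _)).mul du).mul
      dη).aestronglyMeasurable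
  · have hK := gKernel_nonneg h m s p z.1 z.2
    set a := u z.1 - u z.2
    set b := η z.1 - η z.2
    have h1 : |a| ^ (p - 2) * |a| = |a| ^ (p - 1) := by
      simpa only [abs_abs] using abs_rpow_sub_two_mul_self hp (abs_nonneg a)
    have h2 : |a| ^ (p - 1) * |b| ≤ |a| ^ p + |b| ^ p := by
      have e : ∀ c : ℝ, 0 ≤ c → c ^ (p - 1) * c = c ^ p := by
        intro c hc
        rcases hc.eq_or_lt with rfl | h0
        · rw [mul_zero, Real.zero_rpow (by linarith)]
        · rw [← Real.rpow_add_one h0.ne', sub_add_cancel]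
      have hp1 : 0 ≤ p - 1 := by linarith
      rcases le_total |a| |b| with hab | hab
      · calc |a| ^ (p - 1) * |b| ≤ |b| ^ (p - 1) * |b| := by gcongr
          _ = |b| ^ p := e _ (abs_nonneg b)
          _ ≤ _ := le_add_of_nonneg_left (by positivity)
      · calc |a| ^ (p - 1) * |b| ≤ |a| ^ (p - 1) * |a| := by gcongr
          _ = |a| ^ p := e _ (abs_nonneg a)
          _ ≤ _ := le_add_of_nonneg_right (by positivity)
    rw [Real.norm_eq_abs, abs_mul, abs_mul, abs_mul, abs_of_nonneg hK,
      abs_of_nonneg (by positivity : 0 ≤ |a| ^ (p - 2)), mul_assoc (gKernel h m s p z.1 z.2), h1,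
      mul_assoc]
    simp only [Pi.add_apply]
    rw [← mul_add]
    exact mul_le_mul_of_nonneg_left h2 hK

/-- The pointwise estimate of the weak form tested with `φ^p (u₊ + d)^{1-p}`. -/
theorem exists_weakForm_integrand_le {p : ℝ} (hp : 1 < p) :
    ∃ c C : ℝ, 0 < c ∧ 0 < C ∧
      (∀ a b α β d ta tb : ℝ, 0 < d → 0 ≤ α → 0 ≤ β → 0 ≤ ta → 0 ≤ tb →
        (0 ≤ a ∨ α = 0 ∧ ta = max (-a) 0 ^ (p - 1)) →
        (0 ≤ b ∨ β = 0 ∧ tb = max (-b) 0 ^ (p - 1)) →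
        |a - b| ^ (p - 2) * (a - b) *
          (α ^ p * (max a 0 + d) ^ (1 - p) - β ^ p * (max b 0 + d) ^ (1 - p)) ≤
          C * |α - β| ^ p * (1 + d ^ (1 - p) * (ta + tb))) ∧
      ∀ a b d : ℝ, 0 < d → 0 ≤ a → 0 ≤ b →
        c * |Real.log ((a + d) / (b + d))| ^ p + |a - b| ^ (p - 2) * (a - b) *
          ((max a 0 + d) ^ (1 - p) - (max b 0 + d) ^ (1 - p)) ≤ 0 := by
  obtain ⟨c, C, hc, hC, H⟩ := exists_log_test_le hp
  have hp0 : p ≠ 0 := by linarith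
  refine ⟨c, C + 2 ^ (p - 1), hc, by positivity, ?_, ?_⟩
  -- The point with value b has vanishing cutoff, so |α - β|^p = α^p and the bound takes the same
  -- shape as for two nonnegative values: its constant part joins the cutoff energy, the rest the
  -- tail.
  · have outside : ∀ a b α d t t' : ℝ, 0 < d → 0 ≤ α → 0 ≤ t → 0 ≤ a →
        t' = max (-b) 0 ^ (p - 1) →
        |a - b| ^ (p - 2) * (a - b) * (α ^ p * (max a 0 + d) ^ (1 - p)) ≤
          (C + 2 ^ (p - 1)) * α ^ p * (1 + d ^ (1 - p) * (t + t')) := by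
      intro a b α d t t' hd hα ht ha ht'
      have h1 := test_outside_le (b := b) hp ha hd
      rw [← ht'] at h1
      have h2 : 0 ≤ t' := by rw [ht']; positivity
      rw [max_eq_left ha]
      calc _ = α ^ p * (|a - b| ^ (p - 2) * (a - b) * (a + d) ^ (1 - p)) := by ring
        _ ≤ α ^ p * (2 ^ (p - 1) * (1 + d ^ (1 - p) * t')) := by gcongr
        _ = 2 ^ (p - 1) * α ^ p * (1 + d ^ (1 - p) * t') := by ring
        _ ≤ _ := by
          gcongr
          · exact le_add_of_nonneg_left hC.le
          · exact le_add_of_nonneg_left ht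
    intro a b α β d ta tb hd hα hβ hta htb ha hb
    rcases ha with ha | ⟨hα0, hta'⟩
    · rcases hb with hb | ⟨hβ0, htb'⟩
      · have h1 := (H (a + d) (b + d) α β (by linarith) (by linarith) hα hβ).1
        rw [max_eq_left ha, max_eq_left hb]
        rw [add_sub_add_right_eq_sub] at h1
        refine h1.trans ?_
        have h2 : 1 ≤ 1 + d ^ (1 - p) * (ta + tb) := le_add_of_nonneg_right (by positivity)
        calc C * |α - β| ^ p ≤ (C + 2 ^ (p - 1)) * |α - β| ^ p * 1 := by
              rw [mul_one]
              gcongr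
              exact le_add_of_nonneg_right (by positivity)
          _ ≤ _ := by gcongr
      · have h1 := outside a b α d ta tb hd hα hta ha htb'
        rw [hβ0, Real.zero_rpow hp0, zero_mul, sub_zero, sub_zero, abs_of_nonneg hα]
        exact h1
    · rcases hb with hb | ⟨hβ0, htb'⟩
      · have h1 := outside b a β d tb ta hd hβ htb hb hta'
        rw [hα0, Real.zero_rpow hp0, zero_mul, zero_sub, zero_sub, abs_neg, abs_of_nonneg hβ,
          abs_sub_comm, add_comm ta]
        convert h1 using 1
        ring
      · simp [hα0, hβ0, Real.zero_rpow hp0]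
  · intro a b d hd ha hb
    have h1 := (H (a + d) (b + d) 1 1 (by linarith) (by linarith) zero_le_one zero_le_one).2
    rw [add_sub_add_right_eq_sub] at h1
    rwa [max_eq_left ha, max_eq_left hb]

/-- If `L + f ≤ G` with `L` supported on `S` and `∫ f ≥ 0`, then `∫ L ≤ ∫ G`. -/
theorem setLIntegral_le_of_integral_nonneg {α : Type*} [MeasurableSpace α] {μ : Measure α}
    {S : Set α} (hS : MeasurableSet S) {L f G : α → ℝ} (hL : ∀ z, 0 ≤ L z) (hf : Integrable f μ)
    (hf0 : 0 ≤ ∫ z, f z ∂μ) (H : ∀ᵐ z ∂μ, S.indicator L z + f z ≤ G z) :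
    ∫⁻ z in S, ENNReal.ofReal (L z) ∂μ ≤ ∫⁻ z, ENNReal.ofReal (G z) ∂μ := by
  have h1 : ∫⁻ z in S, ENNReal.ofReal (L z) ∂μ =
      ∫⁻ z, ENNReal.ofReal (S.indicator L z) ∂μ := by
    rw [← lintegral_indicator hS]
    refine lintegral_congr fun z => ?_
    by_cases hz : z ∈ S <;> simp [hz]
  have hfm := hf.aestronglyMeasurable.aemeasurable
  have hfin : ∫⁻ z, ENNReal.ofReal (f z) ∂μ ≠ ⊤ := hf.lintegral_lt_top.ne
  have hneg : ∫⁻ z, ENNReal.ofReal (-f z) ∂μ ≤ ∫⁻ z, ENNReal.ofReal (f z) ∂μ := by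
    have h2 := integral_eq_lintegral_pos_part_sub_lintegral_neg_part hf
    rw [h2, sub_nonneg] at hf0
    exact (ENNReal.toReal_le_toReal hf.neg.lintegral_lt_top.ne hfin).1 hf0
  rw [h1]
  -- Adding the finite integral of the positive part of f replaces subtraction, so neither
  -- measurability nor integrability of L and G is required.
  refine (ENNReal.add_le_add_iff_right hfin).1 ?_
  calc _ = ∫⁻ z, (ENNReal.ofReal (S.indicator L z) + ENNReal.ofReal (f z)) ∂μ :=
        (lintegral_add_right' _ hfm.ennreal_ofReal).symm
    _ ≤ ∫⁻ z, (ENNReal.ofReal (G z) + ENNReal.ofReal (-f z)) ∂μ := by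
        refine lintegral_mono_ae ?_
        filter_upwards [H] with z hz
        have hLz : 0 ≤ S.indicator L z := indicator_nonneg (fun z _ => hL z) z
        rcases le_total 0 (f z) with h0 | h0
        · rw [← ENNReal.ofReal_add hLz h0]
          exact (ENNReal.ofReal_le_ofReal hz).trans le_self_add
        · rw [ENNReal.ofReal_of_nonpos h0, add_zero]
          exact (ENNReal.ofReal_le_ofReal (by linarith)).trans ENNReal.ofReal_add_le
    _ = ∫⁻ z, ENNReal.ofReal (G z) ∂μ + ∫⁻ z, ENNReal.ofReal (-f z) ∂μ :=
        lintegral_add_right' _ hfm.neg.ennreal_ofReal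
    _ ≤ _ := by gcongr

/-! ### The tail term -/

section Tail

variable {n h m : ℕ} {x₀ : GSpace n} {r R p s : ℝ} {u : GSpace n → ℝ}

/-- The density `u_-^{p-1}` of the tail outside `B(x₀, R)`. -/
noncomputable def tailDensity {n : ℕ} (h m : ℕ) (p : ℝ) (x₀ : GSpace n) (R : ℝ)
    (u : GSpace n → ℝ) : GSpace n → ℝ :=
  (ccBall h m x₀ R)ᶜ.indicator fun x => max (-u x) 0 ^ (p - 1)

theorem tailDensity_nonneg (x : GSpace n) : 0 ≤ tailDensity h m p x₀ R u x :=
  indicator_nonneg (fun _ _ => Real.rpow_nonneg (le_max_right _ _) _) x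

theorem aemeasurable_tailDensity (hh : 1 ≤ h) (hhn : h ≤ n) (hu : AEMeasurable u) :
    AEMeasurable (tailDensity h m p x₀ R u) :=
  ((hu.neg.max aemeasurable_const).pow_const _).indicator
    (isOpen_ccBall hh hhn m x₀ R).measurableSet.compl

/-- Here d_C(x, x₀) < 3r/2 ≤ (3/4) d_C(y, x₀), so the triangle inequality leaves d_C(x, y) ≥ d_C(y,
x₀)/4. -/
theorem gKernel_le_of_far (hh : 1 ≤ h) (hhn : h ≤ n) (hsp : 0 < s * p) (hr : 0 < r)
    (hrR : 2 * r ≤ R) {x y : GSpace n} (hx : dC h m x x₀ < 3 / 2 * r) (hy : R ≤ dC h m y x₀) :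
    gKernel h m s p x y ≤ 4 ^ ((homDim n h m : ℝ) + s * p) * gKernel h m s p y x₀ := by
  have h1 := dC_triangle hh hhn m y x x₀
  rw [dC_comm h m y x] at h1
  have hpos : 0 < dC h m y x₀ := by linarith
  have h2 : 4⁻¹ * dC h m y x₀ ≤ dC h m x y := by linarith
  have hneg : -(homDim n h m : ℝ) - s * p ≤ 0 := by
    have : (0 : ℝ) ≤ homDim n h m := Nat.cast_nonneg _
    linarith
  calc gKernel h m s p x y ≤ (4⁻¹ * dC h m y x₀) ^ (-(homDim n h m : ℝ) - s * p) :=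
        Real.rpow_le_rpow_of_nonpos (by positivity) h2 hneg
    _ = _ := by
        rw [Real.mul_rpow (by norm_num) hpos.le, Real.inv_rpow (by norm_num),
          ← Real.rpow_neg (by norm_num), gKernel]
        ring_nf

/-- The integrand vanishes unless the second point is outside B(x₀, R) and the first in B(x₀, 3r/2).
There the kernel can be centered at x₀, so the variables separate. -/
theorem lintegral_tail_le (hh : 1 ≤ h) (hhn : h ≤ n) (hp : 1 < p) (hsp : 0 < s * p) (hr : 0 < r)
    (hrR : 2 * r ≤ R) (hu : AEMeasurable u) :
    ∫⁻ z : GSpace n × GSpace n, ENNReal.ofReal (gKernel h m s p z.1 z.2 *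
        |ccCutoff h m x₀ r z.1 - ccCutoff h m x₀ r z.2| ^ p * tailDensity h m p x₀ R u z.2) ≤
      volume (ccBall h m x₀ (2 * r)) * (ENNReal.ofReal (4 ^ ((homDim n h m : ℝ) + s * p)) *
        ∫⁻ x in (ccBall h m x₀ R)ᶜ,
          ENNReal.ofReal (|max (-u x) 0| ^ (p - 1) * gKernel h m s p x x₀)) := by
  have hBm := (isOpen_ccBall hh hhn m x₀ (2 * r)).measurableSet
  have hRm := (isOpen_ccBall hh hhn m x₀ R).measurableSet.compl
  have hKm : Measurable fun x : GSpace n => gKernel h m s p x x₀ :=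
    (continuous_dC_left hh hhn m x₀).measurable.pow_const _
  have hvm : AEMeasurable fun x => |max (-u x) 0| := by
    have h0 : AEMeasurable fun x => max (-u x) 0 := hu.neg.max aemeasurable_const
    simpa only [Real.norm_eq_abs] using h0.norm
  have hgm : AEMeasurable fun x : GSpace n => (ccBall h m x₀ R)ᶜ.indicator
      (fun x => ENNReal.ofReal (|max (-u x) 0| ^ (p - 1) * gKernel h m s p x x₀)) x :=
    ((hvm.pow_const _).mul hKm.aemeasurable).ennreal_ofReal.indicator hRm
  have hpt : ∀ z : GSpace n × GSpace n, ENNReal.ofReal (gKernel h m s p z.1 z.2 *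
      |ccCutoff h m x₀ r z.1 - ccCutoff h m x₀ r z.2| ^ p * tailDensity h m p x₀ R u z.2) ≤
      (ccBall h m x₀ (2 * r)).indicator 1 z.1 *
        (ENNReal.ofReal (4 ^ ((homDim n h m : ℝ) + s * p)) * (ccBall h m x₀ R)ᶜ.indicator
          (fun x => ENNReal.ofReal (|max (-u x) 0| ^ (p - 1) * gKernel h m s p x x₀)) z.2) := by
    rintro ⟨x, y⟩
    simp only
    by_cases hy : y ∈ (ccBall h m x₀ R)ᶜ
    · have hy' : R ≤ dC h m y x₀ := not_lt.1 hy
      have hφy : ccCutoff h m x₀ r y = 0 := ccCutoff_eq_zero hr (by linarith)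
      by_cases hx : dC h m x x₀ < 3 / 2 * r
      · have hxB : x ∈ ccBall h m x₀ (2 * r) := show dC h m x x₀ < 2 * r by linarith
        have hφ : |ccCutoff h m x₀ r x - ccCutoff h m x₀ r y| ^ p ≤ 1 := by
          rw [hφy, sub_zero, abs_of_nonneg (ccCutoff_nonneg x)]
          exact Real.rpow_le_one (ccCutoff_nonneg x) (ccCutoff_le_one x) (by linarith)
        have hK := gKernel_nonneg h m s p x y
        have hK' := gKernel_nonneg h m s p y x₀
        rw [tailDensity, indicator_of_mem hy, indicator_of_mem hy, indicator_of_mem hxB,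
          Pi.one_apply, one_mul, ← ENNReal.ofReal_mul (by positivity),
          abs_of_nonneg (le_max_right (-u y) 0)]
        refine ENNReal.ofReal_le_ofReal ?_
        calc _ ≤ 4 ^ ((homDim n h m : ℝ) + s * p) * gKernel h m s p y x₀ * 1 *
              max (-u y) 0 ^ (p - 1) := by
              gcongr
              exact gKernel_le_of_far hh hhn hsp hr hrR hx hy'
          _ = _ := by ring
      · rw [ccCutoff_eq_zero hr (not_lt.1 hx), hφy]
        simp [Real.zero_rpow (by linarith : p ≠ 0)]
    · rw [tailDensity, indicator_of_notMem hy]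
      simp
  refine (lintegral_mono hpt).trans (le_of_eq ?_)
  rw [Measure.volume_eq_prod, lintegral_prod_mul (measurable_one.indicator hBm).aemeasurable
    (hgm.const_mul _), lintegral_indicator_one hBm, lintegral_const_mul' _ _ ENNReal.ofReal_ne_top,
    lintegral_indicator hRm]

theorem gTail_rpow (hp : 1 < p) (v : GSpace n → ℝ) :
    gTail h m s p v x₀ R ^ (p - 1) = ENNReal.ofReal (R ^ (s * p)) *
      ∫⁻ x in (ccBall h m x₀ R)ᶜ, ENNReal.ofReal (|v x| ^ (p - 1) * gKernel h m s p x x₀) := by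
  rw [gTail, ← ENNReal.rpow_mul, one_div_mul_cancel (by linarith), ENNReal.rpow_one]

end Tail

/-! ### Assembly of the logarithmic estimate -/

/-- The energy form of the logarithmic estimate. -/
theorem exists_lintegral_log_le {n h m : ℕ} (hh : 1 ≤ h) (hhn : h ≤ n) {s p : ℝ} (hp : 1 < p)
    (hsp : 0 < s * p) (hspm : s * p + (m * (n - h) : ℕ) < p) :
    ∃ C : ℝ, 0 < C ∧ ∀ (Ω : Set (GSpace n)) (g u : GSpace n → ℝ),
      IsWeakSupersolution h m s p Ω g u → ∀ (x₀ : GSpace n) (r R d : ℝ), 0 < r → 2 * r ≤ R →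
      0 < d → ccBall h m x₀ R ⊆ Ω → (∀ᵐ x, x ∈ ccBall h m x₀ R → 0 ≤ u x) →
        ∫⁻ z in ccBall h m x₀ r ×ˢ ccBall h m x₀ r,
            ENNReal.ofReal (gKernel h m s p z.1 z.2 *
              |Real.log ((u z.1 + d) / (u z.2 + d))| ^ p) ≤
          ENNReal.ofReal C * (gagliardo h m s p (ccCutoff h m x₀ r) +
            ENNReal.ofReal (2 * d ^ (1 - p)) * (volume (ccBall h m x₀ (2 * r)) *
              (ENNReal.ofReal (4 ^ ((homDim n h m : ℝ) + s * p)) *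
                ∫⁻ x in (ccBall h m x₀ R)ᶜ,
                  ENNReal.ofReal (|max (-u x) 0| ^ (p - 1) * gKernel h m s p x x₀)))) := by
  obtain ⟨c, C, hc, hC, H, H'⟩ := exists_weakForm_integrand_le hp
  refine ⟨C / c, by positivity, fun Ω g u hu x₀ r R d hr hrR hd hΩ hupos => ?_⟩
  have hp0 : p ≠ 0 := by linarith
  have hum := hu.mem.1.aestronglyMeasurable.aemeasurable
  have hsub : ccBall h m x₀ (2 * r) ⊆ Ω := fun x hx => hΩ (lt_of_lt_of_le hx hrR)
  have hη := memWsp0_logTest hh hhn hp hsp hspm hr hd hu.mem hsub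
  have hw := hu.weak _ hη (Filter.Eventually.of_forall fun x => logTest_nonneg hd x)
  have hint := integrable_weakForm hh hhn hp hu.mem hη.1
  have hBm := (isOpen_ccBall hh hhn m x₀ r).measurableSet
  set φ := ccCutoff h m x₀ r with hφ
  set τ := tailDensity h m p x₀ R u with hτ
  set J := ∫⁻ x in (ccBall h m x₀ R)ᶜ,
    ENNReal.ofReal (|max (-u x) 0| ^ (p - 1) * gKernel h m s p x x₀) with hJ
  set T : GSpace n × GSpace n → ℝ := fun z =>
    gKernel h m s p z.1 z.2 * |φ z.1 - φ z.2| ^ p * τ z.2 with hT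
  have hKφ : ∀ z : GSpace n × GSpace n, 0 ≤ gKernel h m s p z.1 z.2 * |φ z.1 - φ z.2| ^ p :=
    fun z => mul_nonneg (gKernel_nonneg _ _ _ _ _ _) (by positivity)
  have hT0 : ∀ z, 0 ≤ T z := fun z => mul_nonneg (hKφ z) (tailDensity_nonneg _)
  have hφm : AEMeasurable φ := (measurable_ccCutoff hh hhn).aemeasurable
  have hTm : AEMeasurable fun z => ENNReal.ofReal (T z) :=
    ((aemeasurable_gagliardo_integrand hh hhn hφm).mul
      ((aemeasurable_tailDensity hh hhn hum).comp_quasiMeasurePreserving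
        Measure.quasiMeasurePreserving_snd)).ennreal_ofReal
  have hTint := lintegral_tail_le (m := m) (x₀ := x₀) hh hhn hp hsp hr hrR hum
  -- On B_r × B_r the weak integrand already absorbs the logarithmic term and the right side is only
  -- needed to be nonnegative; off it the indicator vanishes and the cutoff and tail bound applies.
  have key : ∀ᵐ z : GSpace n × GSpace n,
      (ccBall h m x₀ r ×ˢ ccBall h m x₀ r).indicator (fun z => c * (gKernel h m s p z.1 z.2 *
          |Real.log ((u z.1 + d) / (u z.2 + d))| ^ p)) z +
        gKernel h m s p z.1 z.2 * |u z.1 - u z.2| ^ (p - 2) * (u z.1 - u z.2) *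
          (logTest h m p x₀ r d u z.1 - logTest h m p x₀ r d u z.2) ≤
      C * (gKernel h m s p z.1 z.2 * |φ z.1 - φ z.2| ^ p +
        d ^ (1 - p) * (T z + T z.swap)) := by
    have hpos1 : ∀ᵐ z : GSpace n × GSpace n, z.1 ∈ ccBall h m x₀ R → 0 ≤ u z.1 :=
      Measure.quasiMeasurePreserving_fst.ae hupos
    have hpos2 : ∀ᵐ z : GSpace n × GSpace n, z.2 ∈ ccBall h m x₀ R → 0 ≤ u z.2 :=
      Measure.quasiMeasurePreserving_snd.ae hupos
    filter_upwards [hpos1, hpos2] with z hz1 hz2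
    have hK := gKernel_nonneg h m s p z.1 z.2
    by_cases hz : z ∈ ccBall h m x₀ r ×ˢ ccBall h m x₀ r
    · have hz1r : dC h m z.1 x₀ < r := hz.1
      have hz2r : dC h m z.2 x₀ < r := hz.2
      have hu1 : 0 ≤ u z.1 := hz1 (show dC h m z.1 x₀ < R by linarith)
      have hu2 : 0 ≤ u z.2 := hz2 (show dC h m z.2 x₀ < R by linarith)
      have h1 := mul_le_mul_of_nonneg_left (H' (u z.1) (u z.2) d hd hu1 hu2) hK
      rw [indicator_of_mem hz, logTest, logTest, ccCutoff_eq_one hr hz1r.le,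
        ccCutoff_eq_one hr hz2r.le, Real.one_rpow, one_mul, one_mul]
      have h2 : 0 ≤ C * (gKernel h m s p z.1 z.2 * |φ z.1 - φ z.2| ^ p +
          d ^ (1 - p) * (T z + T z.swap)) :=
        mul_nonneg hC.le (add_nonneg (hKφ z) (mul_nonneg (by positivity)
          (add_nonneg (hT0 _) (hT0 _))))
      refine le_trans (le_of_eq ?_) (h1.trans ((mul_zero _).trans_le h2))
      ring
    · have alt : ∀ x, (x ∈ ccBall h m x₀ R → 0 ≤ u x) →
          0 ≤ u x ∨ φ x = 0 ∧ τ x = max (-u x) 0 ^ (p - 1) := by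
        intro x hx
        by_cases hxR : x ∈ ccBall h m x₀ R
        · exact Or.inl (hx hxR)
        · have hx' : R ≤ dC h m x x₀ := not_lt.1 hxR
          exact Or.inr ⟨ccCutoff_eq_zero hr (by linarith), indicator_of_mem hxR _⟩
      have h1 := mul_le_mul_of_nonneg_left (H (u z.1) (u z.2) (φ z.1) (φ z.2) d (τ z.1) (τ z.2) hd
        (ccCutoff_nonneg _) (ccCutoff_nonneg _) (tailDensity_nonneg _) (tailDensity_nonneg _)
        (alt _ hz1) (alt _ hz2)) hK
      rw [indicator_of_notMem hz, zero_add]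
      have hsw : T z.swap = gKernel h m s p z.1 z.2 * |φ z.1 - φ z.2| ^ p * τ z.1 := by
        simp only [hT, Prod.fst_swap, Prod.snd_swap]
        rw [gKernel_comm, abs_sub_comm]
      rw [hsw]
      refine le_trans (le_of_eq ?_) (h1.trans (le_of_eq ?_))
      · simp only [logTest, ← hφ]; ring
      · simp only [hT]; ring
  have main := setLIntegral_le_of_integral_nonneg (hBm.prod hBm)
    (fun z => mul_nonneg hc.le (mul_nonneg (gKernel_nonneg h m s p z.1 z.2) (by positivity)))
    hint hw key
  have hTsw : ∫⁻ z : GSpace n × GSpace n, ENNReal.ofReal (T z.swap) = ∫⁻ z, ENNReal.ofReal (T z) :=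
    lintegral_prod_swap fun z => ENNReal.ofReal (T z)
  have hd' : 0 ≤ d ^ (1 - p) := by positivity
  have hG : ∫⁻ z : GSpace n × GSpace n, ENNReal.ofReal
      (C * (gKernel h m s p z.1 z.2 * |φ z.1 - φ z.2| ^ p + d ^ (1 - p) * (T z + T z.swap))) =
      ENNReal.ofReal C * (gagliardo h m s p φ +
        ENNReal.ofReal (2 * d ^ (1 - p)) * ∫⁻ z, ENNReal.ofReal (T z)) := by
    have e : ∀ z : GSpace n × GSpace n, ENNReal.ofReal
        (C * (gKernel h m s p z.1 z.2 * |φ z.1 - φ z.2| ^ p + d ^ (1 - p) * (T z + T z.swap))) =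
        ENNReal.ofReal C * (ENNReal.ofReal (gKernel h m s p z.1 z.2 * |φ z.1 - φ z.2| ^ p) +
          ENNReal.ofReal (d ^ (1 - p)) * (ENNReal.ofReal (T z) + ENNReal.ofReal (T z.swap))) := by
      intro z
      rw [ENNReal.ofReal_mul hC.le, ENNReal.ofReal_add (hKφ z)
        (mul_nonneg hd' (add_nonneg (hT0 _) (hT0 _))), ENNReal.ofReal_mul hd',
        ENNReal.ofReal_add (hT0 _) (hT0 _)]
    rw [lintegral_congr e, lintegral_const_mul' _ _ ENNReal.ofReal_ne_top,
      lintegral_add_left' (aemeasurable_gagliardo_integrand hh hhn hφm).ennreal_ofReal,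
      lintegral_const_mul' _ _ ENNReal.ofReal_ne_top, lintegral_add_left' hTm, hTsw, ← two_mul,
      ENNReal.ofReal_mul two_pos.le, ENNReal.ofReal_ofNat, gagliardo]
    ring
  rw [hG] at main
  have hLc : ∫⁻ z in ccBall h m x₀ r ×ˢ ccBall h m x₀ r, ENNReal.ofReal
      (c * (gKernel h m s p z.1 z.2 * |Real.log ((u z.1 + d) / (u z.2 + d))| ^ p)) =
      ENNReal.ofReal c * ∫⁻ z in ccBall h m x₀ r ×ˢ ccBall h m x₀ r, ENNReal.ofReal
      (gKernel h m s p z.1 z.2 * |Real.log ((u z.1 + d) / (u z.2 + d))| ^ p) := by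
    rw [← lintegral_const_mul' _ _ ENNReal.ofReal_ne_top]
    exact lintegral_congr fun z => ENNReal.ofReal_mul hc.le
  rw [hLc] at main
  have main' := mul_le_mul_right main (ENNReal.ofReal c⁻¹)
  rw [← mul_assoc, ← mul_assoc, ← ENNReal.ofReal_mul (by positivity), inv_mul_cancel₀ hc.ne',
    ENNReal.ofReal_one, one_mul, ← ENNReal.ofReal_mul (by positivity), inv_mul_eq_div] at main'
  refine main'.trans ?_
  gcongr

theorem theorem1p4 (n h m : ℕ) (hh : 1 ≤ h) (hhn : h ≤ n) (hQ : homDim n h m < 2 * n)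
    (p s : ℝ) (hp : max ((m : ℝ) * ((n : ℝ) - h)) 1 < p)
    (hs0 : 0 < s) (hs1 : s < 1 - (m : ℝ) * ((n : ℝ) - h) / p) :
    ∃ c : ℝ, 0 < c ∧
      ∀ (Ω : Set (GSpace n)), IsOpen Ω → Bornology.IsBounded Ω →
      ∀ (g u : GSpace n → ℝ), MemWsp h m s p g → IsWeakSupersolution h m s p Ω g u →
      ∀ (x₀ : GSpace n) (R : ℝ), 0 < R → ccBall h m x₀ R ⊆ Ω →
      (∀ᵐ x, x ∈ ccBall h m x₀ R → 0 ≤ u x) →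
      ∀ r : ℝ, 0 < r → ccBall h m x₀ r ⊆ ccBall h m x₀ (R / 2) →
      ∀ d : ℝ, 0 < d →
        ∫⁻ z in ccBall h m x₀ r ×ˢ ccBall h m x₀ r,
            ENNReal.ofReal (gKernel h m s p z.1 z.2 *
              |Real.log ((u z.1 + d) / (u z.2 + d))| ^ p)
          ≤ ENNReal.ofReal (c * r ^ (2 * (n : ℝ) - homDim n h m - s * p) *
                (hNorm h x₀ + 2 * r) ^ (m * (n - h))) *
              (ENNReal.ofReal (d ^ (1 - p) * (r / R) ^ (s * p) * r ^ ((homDim n h m : ℝ) - n)) *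
                  gTail h m s p (fun x => max (-u x) 0) x₀ R ^ (p - 1)
                + ENNReal.ofReal ((hNorm h x₀ + 2 * r) ^ (m * (n - h)))) := by
  have hp1 : 1 < p := (le_max_right _ _).trans_lt hp
  have hp0 : 0 < p := by linarith
  have hsp : 0 < s * p := mul_pos hs0 hp0
  have hspm : s * p + (m * (n - h) : ℕ) < p := by
    have h1 : s * p < (1 - (m : ℝ) * ((n : ℝ) - h) / p) * p := by gcongr
    rw [sub_mul, one_mul, div_mul_cancel₀ _ hp0.ne'] at h1
    push_cast [Nat.cast_sub hhn]
    linarith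
  obtain ⟨C, hC, H⟩ := exists_lintegral_log_le hh hhn hp1 hsp hspm
  obtain ⟨C₁, hC₁, H₁⟩ := exists_gagliardo_ccCutoff_le hh hhn hp0 hsp hspm
  have hn0 : (0 : ℝ) < n := by exact_mod_cast (by omega : 0 < n)
  set V : ℝ := 4 ^ n * n ^ (m * (n - h)) with hV
  set W : ℝ := 4 ^ ((homDim n h m : ℝ) + s * p) with hW
  have hV0 : 0 < V := by positivity
  have hW0 : 0 < W := by positivity
  refine ⟨C * (C₁ + 2 * V * W), by positivity, ?_⟩
  intro Ω _ _ g u _ hu x₀ R hR hΩ hupos r hr hrR d hd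
  have hrR' : 2 * r ≤ R := by
    have := le_of_ccBall_subset hh hhn (by positivity) hrR
    linarith
  refine (H Ω g u hu x₀ r R d hr hrR' hd hΩ hupos).trans ?_
  rw [gTail_rpow hp1]
  set J := ∫⁻ x in (ccBall h m x₀ R)ᶜ,
    ENNReal.ofReal (|max (-u x) 0| ^ (p - 1) * gKernel h m s p x x₀) with hJ
  have hN := hNorm_nonneg h x₀
  set N := (hNorm h x₀ + 2 * r) ^ (m * (n - h)) with hNdef
  have hN0 : 0 ≤ N := by positivity
  set P := r ^ (2 * (n : ℝ) - homDim n h m - s * p) * N with hP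
  have hP0 : 0 ≤ P := by positivity
  set D := d ^ (1 - p) * (r / R) ^ (s * p) * r ^ ((homDim n h m : ℝ) - n) with hD
  have hD0 : 0 ≤ D := by positivity
  -- The exponents of r add up to (2n - Q - sp) + sp + (Q - n) = n: the prefactor of the tail in the
  -- statement is d^{1-p} times the volume bound for B(x₀, 2r), up to a constant.
  have e1 : P * (D * R ^ (s * p)) = d ^ (1 - p) * (r ^ n * N) := by
    have a1 : (r / R) ^ (s * p) * R ^ (s * p) = r ^ (s * p) := by
      rw [← Real.mul_rpow (by positivity) hR.le, div_mul_cancel₀ _ hR.ne']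
    have a2 : r ^ (2 * (n : ℝ) - homDim n h m - s * p) * r ^ (s * p) *
        r ^ ((homDim n h m : ℝ) - n) = r ^ n := by
      rw [← Real.rpow_natCast r n, ← Real.rpow_add hr, ← Real.rpow_add hr]
      ring_nf
    calc P * (D * R ^ (s * p)) = d ^ (1 - p) * (r ^ (2 * (n : ℝ) - homDim n h m - s * p) *
          ((r / R) ^ (s * p) * R ^ (s * p)) * r ^ ((homDim n h m : ℝ) - n)) * N := by
          rw [hP, hD]; ring
      _ = _ := by rw [a1, a2]; ring
  have hvol := volume_ccBall_two_mul_le hh hhn m x₀ hr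
  rw [← hV, ← hNdef] at hvol
  have hG := H₁ x₀ r hr
  rw [← hNdef, mul_assoc C₁, ← hP] at hG
  calc _ ≤ ENNReal.ofReal C * (ENNReal.ofReal (C₁ * P * N) +
        ENNReal.ofReal (2 * d ^ (1 - p)) * (ENNReal.ofReal (V * r ^ n * N) *
          (ENNReal.ofReal W * J))) := by gcongr
    _ = ENNReal.ofReal (C * C₁ * P * N) +
          ENNReal.ofReal (C * (2 * V * W) * P * (D * R ^ (s * p))) * J := by
        have e2 : C * (2 * V * W) * P * (D * R ^ (s * p)) =
            C * ((2 * d ^ (1 - p)) * (V * r ^ n * N * W)) := by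
          linear_combination (C * (2 * V * W)) * e1
        have e3 : C * C₁ * P * N = C * (C₁ * P * N) := by ring
        rw [e2, e3, ENNReal.ofReal_mul hC.le, ENNReal.ofReal_mul hC.le,
          ENNReal.ofReal_mul (by positivity : 0 ≤ 2 * d ^ (1 - p)),
          ENNReal.ofReal_mul (by positivity : 0 ≤ V * r ^ n * N)]
        ring
    _ ≤ ENNReal.ofReal (C * (C₁ + 2 * V * W) * P * N) +
          ENNReal.ofReal (C * (C₁ + 2 * V * W) * P * (D * R ^ (s * p))) * J := by
        gcongr
        · exact le_add_of_nonneg_right (by positivity)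
        · exact le_add_of_nonneg_left hC₁.le
    _ = _ := by
        rw [mul_assoc (C * (C₁ + 2 * V * W)) (r ^ _) N, ← hP]
        have hA : 0 ≤ C * (C₁ + 2 * V * W) * P := by positivity
        rw [ENNReal.ofReal_mul hA, ENNReal.ofReal_mul hA, ENNReal.ofReal_mul hD0]
        ring
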